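/- Let $\mathcal V,\mathcal X,\mathcal Y$ be finite non-empty sets, $P$ a probability distribution on $\mathcal V$ (memoryless source), $W(\cdot|x)$, $x\in\mathcal X$, a discrete memoryless channel from $\mathcal X$ to $\mathcal Y$, and $t>0$. Put $$E_s(\rho,P)=\log\Bigl(\sum_v P(v)^{\frac1{1+\rho}}\Bigr)^{1+\rho},\quad E_0(\rho,W,Q)=-\log\sum_y\Bigl(\sum_x Q(x)W(y|x)^{\frac1{1+\rho}}\Bigr)^{1+\rho},\quad E_0(\rho,W)=\max_Q E_0(\rho,W,Q),$$ where $Q$ runs over the probability distributions on $\mathcal X$, and let $\bar E_0(\cdot,W)$ be the concave hull of $E_0(\cdot,W)$ on $[0,1]$, i.e. $\bar E_0(\rho,W)=\max\{\lambda E_0(\rho_1,W)+(1-\lambda)E_0(\rho_2,W):\rho_1,\rho_2,\lambda\in[0,1],\ \lambda\rho_1+(1-\lambda)\rho_2=\rho\}$. Put $e(R,P)=\sup_{\rho\ge0}\{\rho R-E_s(\rho,P)\}$, $E_r(R,W)=\max_{\rho\in[0,1]}\{E_0(\rho,W)-\rho R\}$, $E_{sp}(R,W)=\sup_{\rho\ge0}\{E_0(\rho,W)-\rho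 R\}$ (values in $[0,\infty]$ for $e$ and $E_{sp}$ allowed), $R_{cr}=\inf\{R\ge0: E_r(R,W)=E_{sp}(R,W)\}$, and, with $H(P)$ the entropy of $P$ and $I=[tH(P),\,t\log|\mathcal V|]$, $$E_J^{Cs}=\min_{R\in I}\bigl\{t\,e(R/t,P)+E_r(R,W)\bigr\},\qquad E_J^{Sp}=\inf_{R\in I}\bigl\{t\,e(R/t,P)+E_{sp}(R,W)\bigr\}.$$ (i) $E_J^{Cs}=\max_{\rho\in[0,1]}\{\bar E_0(\rho,W)-tE_s(\rho,P)\}$. (ii) Two classes suffice to attain $E_J^{Cs}$: there are two probability distributions $Q_1,Q_2$ on $\mathcal X$ and, for every $k$, a partition of $\mathcal V^k$ into two classes $\mathcal A_k^{(1)},\mathcal A_k^{(2)}$ (one of them possibly empty) such that, for every sequence of block lengths $n=n_k$ with $k/n_k\to t$, the following holds. Draw the codewords $x(v)\in\mathcal X^{n}$, $v\in\mathcal V^k$, independently, the letters of $x(v)$ being i.i.d. with law $Q_i$ when $v\in\mathcal A_k^{(i)}$. Then the error probability of maximum a posteriori decoding, averaged over this ensemble, is at most $e^{-nE_J^{Cs}+o(n)}$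 as $k\to\infty$; hence there is also a sequence of codebooks whose error probabilities are at most $e^{-nE_J^{Cs}+o(n)}$. (iii) This exponent equals the sphere-packing exponent where the latter is known to be tight: $E_J^{Cs}=E_J^{Sp}$ whenever the minimum defining $E_J^{Cs}$ is attained at some $R\in I$ with $E_r(R,W)=E_{sp}(R,W)$, and also whenever the infimum defining $E_J^{Sp}$ is finite and attained at some $R\in I$ with $R>R_{cr}$. -/

import Mathlib

open Set Filter Topology Asymptotics

noncomputable section

namespace JSCC

/-! ### Memoryless source, memoryless channel, codes and random-coding ensembles -/

/-- The product law `p(a₁) ⋯ p(aₘ)` of a memoryless sequence; used for source messages and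
for codewords. -/
def iidProb {A : Type*} {m : ℕ} (p : A → ℝ) (a : Fin m → A) : ℝ := ∏ j, p (a j)

/-- The memoryless channel law `W(y|x) = W(y₁|x₁) ⋯ W(yₙ|xₙ)`. -/
def channelProb {X Y : Type*} {n : ℕ} (W : X → Y → ℝ) (x : Fin n → X) (y : Fin n → Y) : ℝ :=
  ∏ j, W (x j) (y j)

/-- A codebook assigns a codeword of length `n` to each source message of length `k`. -/
abbrev Codebook (V X : Type*) (k n : ℕ) : Type _ := (Fin k → V) → (Fin n → X)

/-- The maximum a posteriori decoder: a message maximizing `P(v) W(y|x(v))`. How ties are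
resolved does not affect the error probability. -/
def mapDecoder {V X Y : Type*} [Fintype V] [Nonempty V] {k n : ℕ} (P : V → ℝ) (W : X → Y → ℝ)
    (c : Codebook V X k n) (y : Fin n → Y) : Fin k → V :=
  Classical.choose
    (Finite.exists_max fun v : Fin k → V => iidProb P v * channelProb W (c v) y)

/-- The error probability `Pr {V̂ ≠ V}` of a codebook under MAP decoding. -/
def errorProb {V X Y : Type*} [Fintype V] [DecidableEq V] [Nonempty V] [Fintype Y] {k n : ℕ}
    (P : V → ℝ) (W : X → Y → ℝ) (c : Codebook V X k n) : ℝ :=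
  ∑ v : Fin k → V, ∑ y : Fin n → Y,
    if mapDecoder P W c y = v then 0 else iidProb P v * channelProb W (c v) y

/-- The error probability averaged over the ensemble with `N` classes: `cls` is the partition of
the messages into classes (class `i` is its fibre over `i`), the codewords are independent, and the
codeword of a message of class `i` has i.i.d. letters of law `Q i`. -/
def ensembleErrorProb {V X Y : Type*} [Fintype V] [DecidableEq V] [Nonempty V] [Fintype X]
    [Fintype Y] {N k : ℕ} (n : ℕ) (P : V → ℝ) (W : X → Y → ℝ)
    (cls : (Fin k → V) → Fin N) (Q : Fin N → X → ℝ) : ℝ :=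
  ∑ c : Codebook V X k n, (∏ v, iidProb (Q (cls v)) (c v)) * errorProb P W c

/-! ### Gallager's functions -/

/-- Gallager's source function `E_s(ρ, P)`. -/
def Es {V : Type*} [Fintype V] (P : V → ℝ) (ρ : ℝ) : ℝ :=
  Real.log ((∑ v, P v ^ (1 / (1 + ρ))) ^ (1 + ρ))

/-- Gallager's channel function `E_0(ρ, W, Q)` of an input distribution `Q`. -/
def E0 {X Y : Type*} [Fintype X] [Fintype Y] (W : X → Y → ℝ) (Q : X → ℝ) (ρ : ℝ) : ℝ :=
  -Real.log (∑ y, (∑ x, Q x * W x y ^ (1 / (1 + ρ))) ^ (1 + ρ))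

/-- `E_0(ρ, W)`: the maximum of `E_0(ρ, W, Q)` over all input distributions `Q`. -/
def E0max {X Y : Type*} [Fintype X] [Fintype Y] (W : X → Y → ℝ) (ρ : ℝ) : ℝ :=
  sSup ((fun Q : X → ℝ => E0 W Q ρ) '' stdSimplex ℝ X)

/-- The concave hull `Ē_0(ρ, W)` of `E_0(·, W)` on `[0, 1]`. -/
def E0hull {X Y : Type*} [Fintype X] [Fintype Y] (W : X → Y → ℝ) (ρ : ℝ) : ℝ :=
  sSup {z : ℝ | ∃ ρ₁ ∈ Icc (0 : ℝ) 1, ∃ ρ₂ ∈ Icc (0 : ℝ) 1, ∃ l ∈ Icc (0 : ℝ) 1,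
    l * ρ₁ + (1 - l) * ρ₂ = ρ ∧ z = l * E0max W ρ₁ + (1 - l) * E0max W ρ₂}

/-- `max_{ρ ∈ [0,1]} {Ē_0(ρ, W) - t E_s(ρ, P)}`. -/
def hullExponent {V X Y : Type*} [Fintype V] [Fintype X] [Fintype Y]
    (P : V → ℝ) (W : X → Y → ℝ) (t : ℝ) : ℝ :=
  sSup ((fun ρ : ℝ => E0hull W ρ - t * Es P ρ) '' Icc (0 : ℝ) 1)

/-! ### Source and channel exponents; these may be infinite -/

/-- The source reliability function `e(R, P)`. -/
def sourceExponent {V : Type*} [Fintype V] (P : V → ℝ) (R : ℝ) : EReal :=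
  ⨆ ρ ∈ Ici (0 : ℝ), ((ρ * R - Es P ρ : ℝ) : EReal)

/-- The random-coding exponent `E_r(R, W)`. -/
def randomCodingExponent {X Y : Type*} [Fintype X] [Fintype Y] (W : X → Y → ℝ) (R : ℝ) : EReal :=
  ⨆ ρ ∈ Icc (0 : ℝ) 1, ((E0max W ρ - ρ * R : ℝ) : EReal)

/-- The sphere-packing exponent `E_sp(R, W)`. -/
def spherePackingExponent {X Y : Type*} [Fintype X] [Fintype Y] (W : X → Y → ℝ) (R : ℝ) : EReal :=
  ⨆ ρ ∈ Ici (0 : ℝ), ((E0max W ρ - ρ * R : ℝ) : EReal)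

/-- The critical rate: from this rate on, `E_r` and `E_sp` coincide. -/
def criticalRate {X Y : Type*} [Fintype X] [Fintype Y] (W : X → Y → ℝ) : ℝ :=
  sInf {R : ℝ | 0 ≤ R ∧ randomCodingExponent W R = spherePackingExponent W R}

/-- The range `t H(V) ≤ R ≤ t log |V|` of rates. -/
def rateRange {V : Type*} [Fintype V] (P : V → ℝ) (t : ℝ) : Set ℝ :=
  Icc (t * ∑ v, Real.negMulLog (P v)) (t * Real.log (Fintype.card V))

/-- The function `t e(R/t, P) + E_r(R, W)` minimized in Csiszár's exponent. -/
def csiszarObjective {V X Y : Type*} [Fintype V] [Fintype X] [Fintype Y]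
    (P : V → ℝ) (W : X → Y → ℝ) (t R : ℝ) : EReal :=
  (t : EReal) * sourceExponent P (R / t) + randomCodingExponent W R

/-- The function `t e(R/t, P) + E_sp(R, W)` minimized in the sphere-packing bound. -/
def spherePackingObjective {V X Y : Type*} [Fintype V] [Fintype X] [Fintype Y]
    (P : V → ℝ) (W : X → Y → ℝ) (t R : ℝ) : EReal :=
  (t : EReal) * sourceExponent P (R / t) + spherePackingExponent W R

/-- Csiszár's joint source-channel exponent `E_J^Cs(P, W, t)`. -/
def csiszarExponent {V X Y : Type*} [Fintype V] [Fintype X] [Fintype Y]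
    (P : V → ℝ) (W : X → Y → ℝ) (t : ℝ) : EReal :=
  ⨅ R ∈ rateRange P t, csiszarObjective P W t R

/-- The joint source-channel sphere-packing exponent `E_J^Sp(P, W, t)`. -/
def jointSpherePackingExponent {V X Y : Type*} [Fintype V] [Fintype X] [Fintype Y]
    (P : V → ℝ) (W : X → Y → ℝ) (t : ℝ) : EReal :=
  ⨅ R ∈ rateRange P t, spherePackingObjective P W t R

end JSCC

end

/-! Everything follows from one supporting line. `Es` is convex with derivative `tiltedEntropy`, so
it lies above its tangents (`Es_tangent`). At a maximizer `m` of the hull minus `t * Es`, the line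
of slope `t * tiltedEntropy P m` lies above `E0max` on `[0, 1]` and touches it at some `ρ₁ ≤ m ≤ ρ₂`
(`exists_supporting_line`). Let `M` be the maximum.

For (i), the slope `R* = t * tiltedEntropy P m` is itself an optimal rate. At `R*` the tangent of
`Es` and the supporting line bound the objective by `M`. At any other rate, `m` together with one of
`ρ₁`, `ρ₂` shows that the objective is at least `M`.

For (ii), messages are split by a probability threshold; improbable ones use `ρ₁`, probable ones
`ρ₂`. Gallager's bound holds with a separate parameter for each class (`ensembleErrorProb_le`).
Restriction to a class replaces `Es (ρᵢ)` by the value at `ρᵢ` of the tangent at `m`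
(`class_partitionSum_le`). Since `ρᵢ` is a contact point, each class has exponent exactly `M`.

For (iii), equality of the two channel exponents persists at larger rates, and the Csiszár objective
is convex in the rate. -/

namespace JSCC

/-! ### The source function -/

/-- Gibbs' inequality. -/
lemma sum_negMulLog_add_mul_log_le {V : Type*} [Fintype V] {q a : V → ℝ}
    (hq : q ∈ stdSimplex ℝ V) (ha : ∀ v, 0 ≤ a v) (hqa : ∀ v, a v = 0 → q v = 0) :
    ∑ v, (Real.negMulLog (q v) + q v * Real.log (a v)) ≤ Real.log (∑ v, a v) := by
  have hS : 0 < ∑ v, a v := by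
    refine (Finset.sum_nonneg fun v _ => ha v).lt_of_ne' fun h => ?_
    have h0 := (Finset.sum_eq_zero_iff_of_nonneg fun v _ => ha v).1 h
    have : ∑ v, q v = 0 := Finset.sum_eq_zero fun v hv => hqa v (h0 v hv)
    rw [hq.2] at this
    exact one_ne_zero this
  have key : ∀ v, Real.negMulLog (q v) + q v * Real.log (a v)
      -- This is `log x ≤ x - 1` at `x = a v / ((∑ a) * q v)`; the corrections sum to zero.
      ≤ q v * Real.log (∑ v, a v) + (a v / (∑ v, a v) - q v) := by
    intro v
    rcases (hq.1 v).eq_or_lt with h | h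
    · rw [← h]
      simpa using div_nonneg (ha v) hS.le
    · have hav : 0 < a v := (ha v).lt_of_ne' fun h0 => h.ne' (hqa v h0)
      have hlog := Real.log_le_sub_one_of_pos (div_pos hav (mul_pos hS h))
      rw [Real.log_div hav.ne' (mul_pos hS h).ne', Real.log_mul hS.ne' h.ne'] at hlog
      have h2 := mul_le_mul_of_nonneg_left hlog h.le
      have h3 : q v * (a v / ((∑ v, a v) * q v) - 1) = a v / (∑ v, a v) - q v := by
        field_simp
      rw [h3] at h2
      rw [Real.negMulLog]
      linarith
  refine (Finset.sum_le_sum fun v _ => key v).trans_eq ?_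
  rw [Finset.sum_add_distrib, ← Finset.sum_mul, hq.2, Finset.sum_sub_distrib, hq.2,
    ← Finset.sum_div, div_self hS.ne']
  ring

section Source

variable {V : Type*} [Fintype V] {P : V → ℝ}

/-- The partition function `∑ P(v)^{1/(1+ρ)}`. -/
noncomputable def partitionSum (P : V → ℝ) (ρ : ℝ) : ℝ := ∑ v, P v ^ (1 / (1 + ρ))

/-- The tilted distribution, proportional to `P(v)^{1/(1+ρ)}`. -/
noncomputable def tilted (P : V → ℝ) (ρ : ℝ) (v : V) : ℝ := P v ^ (1 / (1 + ρ)) / partitionSum P ρ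

/-- The entropy of the tilted distribution; it is the derivative of `E_s`. -/
noncomputable def tiltedEntropy (P : V → ℝ) (ρ : ℝ) : ℝ := ∑ v, Real.negMulLog (tilted P ρ v)

/-- The expected logarithm of `P` under the tilted distribution. -/
noncomputable def tiltedLog (P : V → ℝ) (ρ : ℝ) : ℝ := ∑ v, tilted P ρ v * Real.log (P v)

lemma exists_pos_of_mem_stdSimplex {A : Type*} [Fintype A] {q : A → ℝ}
    (hq : q ∈ stdSimplex ℝ A) : ∃ x, 0 < q x := by
  by_contra! h
  have h1 := Finset.sum_nonpos fun x (_ : x ∈ Finset.univ) => h x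
  rw [hq.2] at h1
  exact absurd h1 (by norm_num)

lemma partitionSum_pos (hP : P ∈ stdSimplex ℝ V) (ρ : ℝ) : 0 < partitionSum P ρ := by
  obtain ⟨v, hv⟩ := exists_pos_of_mem_stdSimplex hP
  exact Finset.sum_pos' (fun v _ => Real.rpow_nonneg (hP.1 v) _)
    ⟨v, Finset.mem_univ v, Real.rpow_pos_of_pos hv _⟩

lemma Es_eq (hP : P ∈ stdSimplex ℝ V) (ρ : ℝ) :
    Es P ρ = (1 + ρ) * Real.log (partitionSum P ρ) :=
  Real.log_rpow (partitionSum_pos hP ρ) _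

lemma tilted_mem (hP : P ∈ stdSimplex ℝ V) (ρ : ℝ) : tilted P ρ ∈ stdSimplex ℝ V := by
  refine ⟨fun v => div_nonneg (Real.rpow_nonneg (hP.1 v) _) (partitionSum_pos hP ρ).le, ?_⟩
  simp only [tilted]
  rw [← Finset.sum_div]
  exact div_self (partitionSum_pos hP ρ).ne'

lemma tilted_eq_zero {ρ : ℝ} (hρ : 0 ≤ ρ) {v : V} (hv : P v = 0) : tilted P ρ v = 0 := by
  rw [tilted, hv, Real.zero_rpow (by positivity), zero_div]

lemma log_rpow_of_nonneg {x : ℝ} (hx : 0 ≤ x) {s : ℝ} (hs : s ≠ 0) :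
    Real.log (x ^ s) = s * Real.log x := by
  rcases hx.eq_or_lt with h | h
  · rw [← h, Real.zero_rpow hs]; simp
  · exact Real.log_rpow h s

/-- Gibbs' inequality with the weights of `ρ'` and the tilted distribution of `ρ`. The left side is
affine in `ρ'` and, by `Es_eq_tilted`, exact at `ρ' = ρ`; hence it is the tangent, obtained without
differentiating. -/
lemma le_Es (hP : P ∈ stdSimplex ℝ V) {ρ ρ' : ℝ} (hρ : 0 ≤ ρ) (hρ' : 0 ≤ ρ') :
    (1 + ρ') * tiltedEntropy P ρ + tiltedLog P ρ ≤ Es P ρ' := by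
  have h := sum_negMulLog_add_mul_log_le (tilted_mem hP ρ)
    (a := fun v => P v ^ (1 / (1 + ρ'))) (fun v => Real.rpow_nonneg (hP.1 v) _)
    (fun v hv => tilted_eq_zero hρ ((Real.rpow_eq_zero (hP.1 v) (by positivity)).1 hv))
  rw [Es_eq hP]
  have h1 : ∑ v, (Real.negMulLog (tilted P ρ v) + tilted P ρ v * Real.log (P v ^ (1 / (1 + ρ'))))
      = tiltedEntropy P ρ + 1 / (1 + ρ') * tiltedLog P ρ := by
    rw [Finset.sum_add_distrib, tiltedEntropy, tiltedLog, Finset.mul_sum]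
    congr 1
    refine Finset.sum_congr rfl fun v _ => ?_
    rw [log_rpow_of_nonneg (hP.1 v) (by positivity)]
    ring
  rw [h1] at h
  have h2 := mul_le_mul_of_nonneg_left h (by positivity : 0 ≤ 1 + ρ')
  have h3 : (1 + ρ') * (tiltedEntropy P ρ + 1 / (1 + ρ') * tiltedLog P ρ)
      = (1 + ρ') * tiltedEntropy P ρ + tiltedLog P ρ := by
    field_simp
  rw [h3] at h2
  exact h2

lemma Es_eq_tilted (hP : P ∈ stdSimplex ℝ V) {ρ : ℝ} (hρ : 0 ≤ ρ) :
    Es P ρ = (1 + ρ) * tiltedEntropy P ρ + tiltedLog P ρ := by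
  have hZ := partitionSum_pos hP ρ
  have h1 : ∀ v, Real.negMulLog (tilted P ρ v)
      = tilted P ρ v * Real.log (partitionSum P ρ)
        - 1 / (1 + ρ) * (tilted P ρ v * Real.log (P v)) := by
    intro v
    rcases (hP.1 v).eq_or_lt with h | h
    · simp [tilted_eq_zero hρ h.symm]
    · have hl : Real.log (tilted P ρ v)
          = 1 / (1 + ρ) * Real.log (P v) - Real.log (partitionSum P ρ) := by
        rw [tilted, Real.log_div (Real.rpow_pos_of_pos h _).ne' hZ.ne', Real.log_rpow h]
      rw [Real.negMulLog, hl]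
      ring
  have h2 : tiltedEntropy P ρ = Real.log (partitionSum P ρ) - 1 / (1 + ρ) * tiltedLog P ρ := by
    rw [tiltedEntropy, Finset.sum_congr rfl fun v _ => h1 v, Finset.sum_sub_distrib,
      ← Finset.sum_mul, (tilted_mem hP ρ).2, one_mul, ← Finset.mul_sum, tiltedLog]
  rw [Es_eq hP, h2]
  field_simp
  ring

/-- `E_s` lies above its tangents. -/
lemma Es_tangent (hP : P ∈ stdSimplex ℝ V) {ρ ρ' : ℝ} (hρ : 0 ≤ ρ) (hρ' : 0 ≤ ρ') :
    Es P ρ + (ρ' - ρ) * tiltedEntropy P ρ ≤ Es P ρ' := by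
  have := le_Es hP hρ hρ'
  rw [Es_eq_tilted hP hρ]
  linarith

lemma tiltedEntropy_zero (hP : P ∈ stdSimplex ℝ V) :
    tiltedEntropy P 0 = ∑ v, Real.negMulLog (P v) := by
  have h : partitionSum P 0 = 1 := by simp [partitionSum, hP.2]
  simp [tiltedEntropy, tilted, h]

/-- Monotonicity of the slope: add the tangent inequalities at `0` and at `ρ`. -/
lemma tiltedEntropy_ge (hP : P ∈ stdSimplex ℝ V) {ρ : ℝ} (hρ : 0 ≤ ρ) :
    ∑ v, Real.negMulLog (P v) ≤ tiltedEntropy P ρ := by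
  rw [← tiltedEntropy_zero hP]
  rcases hρ.eq_or_lt with h | h
  · rw [h]
  · have h1 := Es_tangent hP hρ le_rfl
    have h2 := Es_tangent hP le_rfl hρ
    nlinarith

lemma tiltedEntropy_le (hP : P ∈ stdSimplex ℝ V) (ρ : ℝ) :
    tiltedEntropy P ρ ≤ Real.log (Fintype.card V) := by
  have h := sum_negMulLog_add_mul_log_le (tilted_mem hP ρ) (a := fun _ => 1)
    (fun _ => zero_le_one) (fun _ h => absurd h one_ne_zero)
  simpa [tiltedEntropy] using h

lemma continuousOn_rpow_inv (x : ℝ) :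
    ContinuousOn (fun ρ : ℝ => x ^ (1 / (1 + ρ))) (Ici 0) := by
  intro ρ hρ
  have hρ' : (0 : ℝ) < 1 + ρ := by have : (0 : ℝ) ≤ ρ := hρ; positivity
  refine ContinuousAt.continuousWithinAt (ContinuousAt.rpow continuousAt_const ?_ ?_)
  · exact continuousAt_const.div (by fun_prop) hρ'.ne'
  · exact Or.inr (by positivity)

lemma continuousOn_tiltedEntropy (hP : P ∈ stdSimplex ℝ V) :
    ContinuousOn (tiltedEntropy P) (Ici 0) := by
  refine continuousOn_finsetSum _ fun v _ => Real.continuous_negMulLog.comp_continuousOn ?_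
  exact (continuousOn_rpow_inv (P v)).div
    (continuousOn_finsetSum _ fun v _ => continuousOn_rpow_inv (P v))
    fun ρ _ => (partitionSum_pos hP ρ).ne'

lemma continuousOn_Es (hP : P ∈ stdSimplex ℝ V) : ContinuousOn (Es P) (Ici 0) := by
  rw [show Es P = fun ρ => (1 + ρ) * Real.log (partitionSum P ρ) from funext (Es_eq hP)]
  exact (by fun_prop : ContinuousOn (fun ρ : ℝ => 1 + ρ) (Ici 0)).mul
    ((continuousOn_finsetSum _ fun v _ => continuousOn_rpow_inv (P v)).log
      fun ρ _ => (partitionSum_pos hP ρ).ne')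

/-- A bound on the difference quotients of `t E_s` at `m` in direction `d` passes to the
derivative. -/
lemma le_of_difference_quotient (hP : P ∈ stdSimplex ℝ V) {t m d A : ℝ} (ht : 0 < t)
    (h : ∃ s₀ > 0, ∀ s, 0 < s → s < s₀ →
      0 ≤ m + s * d ∧ s * A ≤ t * (Es P (m + s * d) - Es P m)) (hm : 0 ≤ m) :
    A ≤ t * tiltedEntropy P m * d := by
  obtain ⟨s₀, hs₀, h⟩ := h
  have hmem : ∀ᶠ s in 𝓝[>] (0 : ℝ), 0 < s ∧ s < s₀ := by
    filter_upwards [Ioo_mem_nhdsGT hs₀] with s hs using hs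
  have hlim : Tendsto (fun s : ℝ => m + s * d) (𝓝[>] 0) (𝓝[Ici 0] m) := by
    refine tendsto_nhdsWithin_iff.2 ⟨?_, hmem.mono fun s hs => (h s hs.1 hs.2).1⟩
    have : ContinuousAt (fun s : ℝ => m + s * d) 0 := by fun_prop
    simpa using this.tendsto.mono_left nhdsWithin_le_nhds
  have h1 : Tendsto (fun s : ℝ => t * tiltedEntropy P (m + s * d) * d) (𝓝[>] 0)
      (𝓝 (t * tiltedEntropy P m * d)) :=
    (((continuousOn_tiltedEntropy hP m hm).tendsto.comp hlim).const_mul t).mul_const d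
  refine ge_of_tendsto h1 (hmem.mono fun s hs => ?_)
  obtain ⟨h2, h3⟩ := h s hs.1 hs.2
  -- The tangent at the moved point, evaluated back at `m`, bounds the increment from above;
  -- continuity of the slope does the rest.
  have h4 := Es_tangent hP h2 hm
  have h5 : s * A ≤ s * (t * tiltedEntropy P (m + s * d) * d) := by
    nlinarith [mul_le_mul_of_nonneg_left h4 ht.le]
  exact le_of_mul_le_mul_left h5 hs.1

end Source

/-! ### The channel function -/

section Channel

variable {X Y : Type*} [Fintype X] [Fintype Y] {W : X → Y → ℝ}

/-- The sum under the logarithm in `E_0(ρ, W, Q)`. -/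
noncomputable def gallagerSum (W : X → Y → ℝ) (Q : X → ℝ) (ρ : ℝ) : ℝ :=
  ∑ y, (∑ x, Q x * W x y ^ (1 / (1 + ρ))) ^ (1 + ρ)

lemma inner_sum_nonneg (hW : ∀ x, W x ∈ stdSimplex ℝ Y) {Q : X → ℝ} (hQ : Q ∈ stdSimplex ℝ X)
    (s : ℝ) (y : Y) : 0 ≤ ∑ x, Q x * W x y ^ s :=
  Finset.sum_nonneg fun x _ => mul_nonneg (hQ.1 x) (Real.rpow_nonneg ((hW x).1 y) _)

lemma gallagerSum_pos (hW : ∀ x, W x ∈ stdSimplex ℝ Y) {Q : X → ℝ} (hQ : Q ∈ stdSimplex ℝ X)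
    (ρ : ℝ) : 0 < gallagerSum W Q ρ := by
  obtain ⟨x, hx⟩ := exists_pos_of_mem_stdSimplex hQ
  obtain ⟨y, hy⟩ := exists_pos_of_mem_stdSimplex (hW x)
  refine Finset.sum_pos' (fun y _ => Real.rpow_nonneg (inner_sum_nonneg hW hQ _ y) _)
    ⟨y, Finset.mem_univ y, Real.rpow_pos_of_pos ?_ _⟩
  exact Finset.sum_pos' (fun x _ => mul_nonneg (hQ.1 x) (Real.rpow_nonneg ((hW x).1 y) _))
    ⟨x, Finset.mem_univ x, mul_pos hx (Real.rpow_pos_of_pos hy _)⟩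

lemma gallagerSum_eq_exp (hW : ∀ x, W x ∈ stdSimplex ℝ Y) {Q : X → ℝ}
    (hQ : Q ∈ stdSimplex ℝ X) (ρ : ℝ) : gallagerSum W Q ρ = Real.exp (-E0 W Q ρ) := by
  rw [E0, neg_neg]
  exact (Real.exp_log (gallagerSum_pos hW hQ ρ)).symm

/-- The parameter space is arbitrary in order to cover both joint continuity in `(ρ, Q)` and
continuity in `Q` alone. -/
lemma continuous_E0 (hW : ∀ x, W x ∈ stdSimplex ℝ Y) {T : Type*} [TopologicalSpace T]
    {r : T → ℝ} {Q : T → X → ℝ} (hr : Continuous r) (hr0 : ∀ p, 0 ≤ r p)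
    (hQ : ∀ x, Continuous fun p => Q p x) (hQm : ∀ p, Q p ∈ stdSimplex ℝ X) :
    Continuous fun p => E0 W (Q p) (r p) := by
  have hpow : ∀ x y, Continuous fun p => W x y ^ (1 / (1 + r p)) := fun x y =>
    (continuousOn_rpow_inv (W x y)).comp_continuous hr hr0
  refine (Continuous.log (continuous_finsetSum _ fun y _ => ?_)
    fun p => (gallagerSum_pos hW (hQm p) _).ne').neg
  refine (continuous_finsetSum _ fun x _ => (hQ x).mul (hpow x y)).rpow (by fun_prop) ?_
  exact fun p => Or.inr (by linarith [hr0 p])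

lemma continuousOn_E0max (hW : ∀ x, W x ∈ stdSimplex ℝ Y) :
    ContinuousOn (E0max W) (Ici 0) := by
  rw [continuousOn_iff_continuous_domRestrict]
  have : CompactSpace (stdSimplex ℝ X) := isCompact_iff_compactSpace.1 (isCompact_stdSimplex ℝ X)
  have h := IsCompact.continuous_sSup
    (f := fun (ρ : Ici (0 : ℝ)) (Q : stdSimplex ℝ X) => E0 W Q.1 ρ.1)
    isCompact_univ
    (continuous_E0 hW (r := fun p : Ici (0 : ℝ) × stdSimplex ℝ X => p.1.1) (Q := fun p => p.2.1)
      (by fun_prop) (fun p => p.1.2)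
      (fun x => (continuous_apply x).comp (continuous_subtype_val.comp continuous_snd))
      fun p => p.2.2)
  convert h using 1
  funext ρ
  rw [Set.domRestrict_apply, E0max]
  congr 1
  ext z
  simp

lemma exists_E0_eq_E0max [Nonempty X] (hW : ∀ x, W x ∈ stdSimplex ℝ Y) {ρ : ℝ} (hρ : 0 ≤ ρ) :
    ∃ Q ∈ stdSimplex ℝ X, E0 W Q ρ = E0max W ρ := by
  have hc : ContinuousOn (fun Q : X → ℝ => E0 W Q ρ) (stdSimplex ℝ X) := by
    rw [continuousOn_iff_continuous_domRestrict]
    exact continuous_E0 hW (r := fun _ : stdSimplex ℝ X => ρ) (Q := fun p => p.1)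
      continuous_const (fun _ => hρ)
      (fun x => (continuous_apply x).comp continuous_subtype_val) fun p => p.2
  have hne : (stdSimplex ℝ X).Nonempty := by
    classical exact ⟨_, single_mem_stdSimplex ℝ (Classical.arbitrary X)⟩
  obtain ⟨Q, hQ, hmax⟩ := (isCompact_stdSimplex ℝ X).exists_isMaxOn hne hc
  refine ⟨Q, hQ, ?_⟩
  refine (IsGreatest.csSup_eq (s := (fun Q : X → ℝ => E0 W Q ρ) '' stdSimplex ℝ X)
    ⟨mem_image_of_mem _ hQ, ?_⟩).symm
  rintro _ ⟨Q', hQ', rfl⟩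
  exact hmax hQ'

lemma E0max_zero [Nonempty X] (hW : ∀ x, W x ∈ stdSimplex ℝ Y) : E0max W 0 = 0 := by
  obtain ⟨Q, hQ, h⟩ := exists_E0_eq_E0max hW le_rfl
  have h1 : ∑ y, ∑ x, Q x * W x y = 1 := by
    rw [Finset.sum_comm]
    simp_rw [← Finset.mul_sum, (hW _).2, mul_one]
    exact hQ.2
  rw [← h, E0]
  simp [h1]

/-- The inner sums add up to at least `1`, because `W ≤ W ^ (1 / (1 + ρ))`; the power-mean
inequality over `Y` then costs a factor `|Y| ^ ρ`. The bound makes the sphere-packing exponent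
vanish at rate `log |Y|`. -/
lemma E0max_le [Nonempty X] (hW : ∀ x, W x ∈ stdSimplex ℝ Y) {ρ : ℝ} (hρ : 0 ≤ ρ) :
    E0max W ρ ≤ ρ * Real.log (Fintype.card Y) := by
  obtain ⟨Q, hQ, h⟩ := exists_E0_eq_E0max hW hρ
  obtain ⟨x₀⟩ := ‹Nonempty X›
  obtain ⟨y₀, -⟩ := exists_pos_of_mem_stdSimplex (hW x₀)
  have hY : (0 : ℝ) < Fintype.card Y := by
    exact_mod_cast Fintype.card_pos_iff.2 ⟨y₀⟩
  have h1 : (1 : ℝ) ≤ ∑ y, ∑ x, Q x * W x y ^ (1 / (1 + ρ)) := by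
    have h0 : ∑ y, ∑ x, Q x * W x y = 1 := by
      rw [Finset.sum_comm]
      simp_rw [← Finset.mul_sum, (hW _).2, mul_one]
      exact hQ.2
    rw [← h0]
    refine Finset.sum_le_sum fun y _ => Finset.sum_le_sum fun x _ =>
      mul_le_mul_of_nonneg_left ?_ (hQ.1 x)
    have hle : W x y ≤ 1 := by
      rw [← (hW x).2]
      exact Finset.single_le_sum (fun y _ => (hW x).1 y) (Finset.mem_univ y)
    rcases ((hW x).1 y).eq_or_lt with h' | h'
    · rw [← h']; exact Real.rpow_nonneg le_rfl _
    · refine Real.self_le_rpow_of_le_one h'.le hle ?_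
      rw [div_le_one (by positivity)]
      linarith
  have h2 := Real.rpow_sum_le_const_mul_sum_rpow_of_nonneg (s := (Finset.univ : Finset Y))
    (f := fun y => ∑ x, Q x * W x y ^ (1 / (1 + ρ))) (p := 1 + ρ) (by linarith)
    fun y _ => inner_sum_nonneg hW hQ _ y
  rw [add_sub_cancel_left, Finset.card_univ] at h2
  have h3 : (1 : ℝ) ≤ (Fintype.card Y : ℝ) ^ ρ * gallagerSum W Q ρ :=
    (Real.one_le_rpow h1 (by positivity)).trans h2
  have h4 := Real.log_nonneg h3
  rw [Real.log_mul (Real.rpow_pos_of_pos hY _).ne' (gallagerSum_pos hW hQ ρ).ne',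
    Real.log_rpow hY, gallagerSum_eq_exp hW hQ, Real.log_exp, h] at h4
  linarith

end Channel

/-! ### Maximizing over the concave hull -/

section Hull

variable {V X Y : Type*} [Fintype V] [Fintype X] [Fintype Y] {P : V → ℝ} {W : X → Y → ℝ}

/-- Compactness is applied to triples (two points and a weight), so no regularity of the hull itself
is needed. -/
lemma exists_hull_maximizer (hP : P ∈ stdSimplex ℝ V) (hW : ∀ x, W x ∈ stdSimplex ℝ Y) (t : ℝ) :
    ∃ a ∈ Icc (0 : ℝ) 1, ∃ b ∈ Icc (0 : ℝ) 1, ∃ l ∈ Icc (0 : ℝ) 1, a ≤ b ∧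
      ∀ a' ∈ Icc (0 : ℝ) 1, ∀ b' ∈ Icc (0 : ℝ) 1, ∀ l' ∈ Icc (0 : ℝ) 1,
        l' * E0max W a' + (1 - l') * E0max W b' - t * Es P (l' * a' + (1 - l') * b')
          ≤ l * E0max W a + (1 - l) * E0max W b - t * Es P (l * a + (1 - l) * b) := by
  set K : Set (ℝ × ℝ × ℝ) := Icc (0 : ℝ) 1 ×ˢ Icc (0 : ℝ) 1 ×ˢ Icc (0 : ℝ) 1 with hK
  have hg1 : ContinuousOn (fun p : ℝ × ℝ × ℝ => E0max W p.1) K :=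
    (continuousOn_E0max hW).comp continuousOn_fst fun p hp => hp.1.1
  have hg2 : ContinuousOn (fun p : ℝ × ℝ × ℝ => E0max W p.2.1) K :=
    (continuousOn_E0max hW).comp (by fun_prop) fun p hp => hp.2.1.1
  have hE : ContinuousOn (fun p : ℝ × ℝ × ℝ => Es P (p.2.2 * p.1 + (1 - p.2.2) * p.2.1)) K := by
    refine (continuousOn_Es hP).comp (f := fun p : ℝ × ℝ × ℝ => p.2.2 * p.1 + (1 - p.2.2) * p.2.1)
      (by fun_prop) fun p hp => ?_
    exact add_nonneg (mul_nonneg hp.2.2.1 hp.1.1) (mul_nonneg (sub_nonneg.2 hp.2.2.2) hp.2.1.1)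
  have hc : ContinuousOn (fun p : ℝ × ℝ × ℝ => p.2.2 * E0max W p.1 + (1 - p.2.2) * E0max W p.2.1
      - t * Es P (p.2.2 * p.1 + (1 - p.2.2) * p.2.1)) K := by
    fun_prop
  obtain ⟨⟨a, b, l⟩, ⟨ha, hb, hl⟩, hmax⟩ :=
    (isCompact_Icc.prod (isCompact_Icc.prod isCompact_Icc)).exists_isMaxOn
      (s := K) ⟨(0, 0, 0), by simp [hK]⟩ hc
  have hmax' : ∀ a' ∈ Icc (0 : ℝ) 1, ∀ b' ∈ Icc (0 : ℝ) 1, ∀ l' ∈ Icc (0 : ℝ) 1,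
        l' * E0max W a' + (1 - l') * E0max W b' - t * Es P (l' * a' + (1 - l') * b')
          ≤ l * E0max W a + (1 - l) * E0max W b - t * Es P (l * a + (1 - l) * b) :=
    fun a' ha' b' hb' l' hl' => hmax (a := (a', b', l')) ⟨ha', hb', hl'⟩
  simp only at ha hb hl
  rcases le_total a b with hab | hab
  · exact ⟨a, ha, b, hb, l, hl, hab, hmax'⟩
  · refine ⟨b, hb, a, ha, 1 - l, ⟨by linarith [hl.2], by linarith [hl.1]⟩, hab, ?_⟩
    rw [sub_sub_cancel, add_comm ((1 - l) * _), add_comm ((1 - l) * _)]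
    exact hmax'

/-- At a maximizer `m` of `Ē_0 - t E_s` the line of slope `t E_s'(m)` supports `E_0(·, W)` from
above, with contact points on both sides of `m`. -/
lemma exists_supporting_line (hP : P ∈ stdSimplex ℝ V) (hW : ∀ x, W x ∈ stdSimplex ℝ Y)
    {t : ℝ} (ht : 0 < t) :
    ∃ m ∈ Icc (0 : ℝ) 1, ∃ ρ₁ ∈ Icc (0 : ℝ) 1, ∃ ρ₂ ∈ Icc (0 : ℝ) 1, ∃ M : ℝ,
      ρ₁ ≤ m ∧ m ≤ ρ₂ ∧
      (∀ ρ ∈ Icc (0 : ℝ) 1, E0max W ρ ≤ M + t * Es P m + t * tiltedEntropy P m * (ρ - m)) ∧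
      E0max W ρ₁ = M + t * Es P m + t * tiltedEntropy P m * (ρ₁ - m) ∧
      E0max W ρ₂ = M + t * Es P m + t * tiltedEntropy P m * (ρ₂ - m) := by
  obtain ⟨a, ha, b, hb, l, hl, hab, hmax⟩ := exists_hull_maximizer (t := t) hP hW
  have hcomb : ∀ a ∈ Icc (0 : ℝ) 1, ∀ b ∈ Icc (0 : ℝ) 1, ∀ l ∈ Icc (0 : ℝ) 1,
      0 ≤ l * a + (1 - l) * b := fun a ha b hb l hl =>
    add_nonneg (mul_nonneg hl.1 ha.1) (mul_nonneg (sub_nonneg.2 hl.2) hb.1)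
  -- a single maximizing point already gives a supporting line
  have single : ∀ m ∈ Icc (0 : ℝ) 1,
      (∀ a' ∈ Icc (0 : ℝ) 1, ∀ b' ∈ Icc (0 : ℝ) 1, ∀ l' ∈ Icc (0 : ℝ) 1,
        l' * E0max W a' + (1 - l') * E0max W b' - t * Es P (l' * a' + (1 - l') * b')
          ≤ E0max W m - t * Es P m) →
      ∃ m ∈ Icc (0 : ℝ) 1, ∃ ρ₁ ∈ Icc (0 : ℝ) 1, ∃ ρ₂ ∈ Icc (0 : ℝ) 1, ∃ M : ℝ,
        ρ₁ ≤ m ∧ m ≤ ρ₂ ∧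
        (∀ ρ ∈ Icc (0 : ℝ) 1, E0max W ρ ≤ M + t * Es P m + t * tiltedEntropy P m * (ρ - m)) ∧
        E0max W ρ₁ = M + t * Es P m + t * tiltedEntropy P m * (ρ₁ - m) ∧
        E0max W ρ₂ = M + t * Es P m + t * tiltedEntropy P m * (ρ₂ - m) := by
    intro m hm hmax
    refine ⟨m, hm, m, hm, m, hm, E0max W m - t * Es P m, le_rfl, le_rfl, fun ρ hρ => ?_,
      by ring, by ring⟩
    have := le_of_difference_quotient (A := E0max W ρ - E0max W m) (d := ρ - m) hP ht
      ⟨1, one_pos, fun s hs hs1 => ?_⟩ hm.1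
    · linarith
    · have hs' : s ∈ Icc (0 : ℝ) 1 := ⟨hs.le, hs1.le⟩
      have e : s * ρ + (1 - s) * m = m + s * (ρ - m) := by ring
      have h1 := hcomb ρ hρ m hm s hs'
      have h2 := hmax ρ hρ m hm s hs'
      rw [e] at h1 h2
      exact ⟨h1, by linarith⟩
  rcases hl.1.eq_or_lt with h0 | h0
  · refine single b hb ?_
    simpa [← h0] using hmax
  rcases hl.2.eq_or_lt with h1 | h1
  · refine single a ha ?_
    simpa [h1] using hmax
  rcases hab.eq_or_lt with h | hab'
  · refine single a ha ?_
    have e1 : l * E0max W a + (1 - l) * E0max W a = E0max W a := by ring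
    have e2 : l * a + (1 - l) * a = a := by ring
    simpa only [← h, e1, e2] using hmax
  have ham : 0 < (l * a + (1 - l) * b) - a := by
    have : (l * a + (1 - l) * b) - a = (1 - l) * (b - a) := by ring
    rw [this]
    exact mul_pos (by linarith) (by linarith)
  have hmb : 0 < b - (l * a + (1 - l) * b) := by
    have : b - (l * a + (1 - l) * b) = l * (b - a) := by ring
    rw [this]
    exact mul_pos h0 (by linarith)
  have hm0 := hcomb a ha b hb l hl
  set m := l * a + (1 - l) * b with hm
  -- The weight is perturbed with both endpoints fixed. As `0 < l < 1`, both signs of `s` are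
  -- available, and the two one-sided bounds force the chord from `a` to `b` to have slope `t *
  -- tiltedEntropy P m`.
  have hshift : ∀ s, 0 ≤ l + s → l + s ≤ 1 → 0 ≤ m + s * (a - b) ∧
      s * (E0max W a - E0max W b) ≤ t * (Es P (m + s * (a - b)) - Es P m) := by
    intro s hs0 hs1
    have e : (l + s) * a + (1 - (l + s)) * b = m + s * (a - b) := by rw [hm]; ring
    have h2 := hcomb a ha b hb (l + s) ⟨hs0, hs1⟩
    have h3 := hmax a ha b hb (l + s) ⟨hs0, hs1⟩
    rw [e] at h2 h3
    exact ⟨h2, by linarith⟩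
  have hup := le_of_difference_quotient (A := E0max W a - E0max W b) (d := a - b) hP ht
    ⟨1 - l, by linarith, fun s hs hs1 => hshift s (by linarith) (by linarith)⟩ hm0
  have hdown := le_of_difference_quotient (A := E0max W b - E0max W a) (d := b - a) hP ht
    ⟨l, h0, fun s hs hs1 => by
      have h2 := hshift (-s) (by linarith) (by linarith)
      have e : m + -s * (a - b) = m + s * (b - a) := by ring
      rw [e] at h2
      exact ⟨h2.1, by linarith [h2.2]⟩⟩ hm0
  have hslope : E0max W a - E0max W b = t * tiltedEntropy P m * (a - b) := by linarith
  have hm1 : m ∈ Icc (0 : ℝ) 1 := ⟨hm0, by linarith [hb.2]⟩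
  set R := t * tiltedEntropy P m with hR
  -- compare with configurations of the same mean
  have hmean : ∀ c ∈ Icc (0 : ℝ) 1, ∀ d ∈ Icc (0 : ℝ) 1, ∀ w ∈ Icc (0 : ℝ) 1,
      w * c + (1 - w) * d = m →
      w * E0max W c + (1 - w) * E0max W d ≤ l * E0max W a + (1 - l) * E0max W b := by
    intro c hc d hd w hw hcd
    have := hmax c hc d hd w hw
    rw [hcd] at this
    linarith
  refine ⟨m, hm1, a, ha, b, hb, l * E0max W a + (1 - l) * E0max W b - t * Es P m,
    by linarith, by linarith, fun ρ hρ => ?_, ?_, ?_⟩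
  · rcases le_total ρ m with hρm | hρm
    · have hpos : 0 < b - ρ := by linarith
      -- This weight gives `ρ` and `b` the mean `m`. If `E0max W ρ` exceeded the line, the chord to
      -- the contact point at `b` would beat the maximum at `m`.
      have hw : (b - m) / (b - ρ) ∈ Icc (0 : ℝ) 1 :=
        ⟨by positivity, by rw [div_le_one hpos]; linarith⟩
      have h2 := hmean ρ hρ b hb _ hw (by field_simp; ring)
      have h3 : E0max W b = l * E0max W a + (1 - l) * E0max W b + R * (b - m) := by
        rw [hm]; linear_combination (-l) * hslope
      have h4 : (b - m) / (b - ρ) * (E0max W ρ - E0max W b + R * (b - ρ)) ≤ 0 := by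
        have : (b - m) / (b - ρ) * (b - ρ) = b - m := by field_simp
        linear_combination h2 + R * this - h3
      have h5 := nonpos_of_mul_nonpos_right h4 (div_pos hmb hpos)
      linarith
    · have hpos : 0 < ρ - a := by linarith
      have hw : (m - a) / (ρ - a) ∈ Icc (0 : ℝ) 1 :=
        ⟨by positivity, by rw [div_le_one hpos]; linarith⟩
      have h2 := hmean ρ hρ a ha _ hw (by field_simp; ring)
      have h3 : E0max W a = l * E0max W a + (1 - l) * E0max W b + R * (a - m) := by
        rw [hm]; linear_combination (1 - l) * hslope
      have h4 : (m - a) / (ρ - a) * (E0max W ρ - E0max W a - R * (ρ - a)) ≤ 0 := by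
        have : (m - a) / (ρ - a) * (ρ - a) = m - a := by field_simp
        linear_combination h2 - R * this - h3
      have h5 := nonpos_of_mul_nonpos_right h4 (div_pos ham hpos)
      linarith
  · rw [hm]; linear_combination (1 - l) * hslope
  · rw [hm]; linear_combination (-l) * hslope

/-- A supporting line identifies the maximum of `Ē_0 - t E_s`. -/
lemma isGreatest_of_supporting_line (hP : P ∈ stdSimplex ℝ V) {t m ρ₁ ρ₂ M : ℝ} (ht : 0 < t)
    (hm : m ∈ Icc (0 : ℝ) 1) (h₁ : ρ₁ ∈ Icc (0 : ℝ) 1) (h₂ : ρ₂ ∈ Icc (0 : ℝ) 1)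
    (h₁m : ρ₁ ≤ m) (hm₂ : m ≤ ρ₂)
    (hle : ∀ ρ ∈ Icc (0 : ℝ) 1,
      E0max W ρ ≤ M + t * Es P m + t * tiltedEntropy P m * (ρ - m))
    (he₁ : E0max W ρ₁ = M + t * Es P m + t * tiltedEntropy P m * (ρ₁ - m))
    (he₂ : E0max W ρ₂ = M + t * Es P m + t * tiltedEntropy P m * (ρ₂ - m)) :
    IsGreatest ((fun ρ : ℝ => E0hull W ρ - t * Es P ρ) '' Icc (0 : ℝ) 1) M := by
  have hub : ∀ ρ z, (∃ ρ₁ ∈ Icc (0 : ℝ) 1, ∃ ρ₂ ∈ Icc (0 : ℝ) 1, ∃ l ∈ Icc (0 : ℝ) 1,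
      l * ρ₁ + (1 - l) * ρ₂ = ρ ∧ z = l * E0max W ρ₁ + (1 - l) * E0max W ρ₂) →
      z ≤ M + t * Es P m + t * tiltedEntropy P m * (ρ - m) := by
    rintro ρ z ⟨a, ha, b, hb, l, hl, hlab, rfl⟩
    have h1 := mul_le_mul_of_nonneg_left (hle a ha) hl.1
    have h2 := mul_le_mul_of_nonneg_left (hle b hb) (sub_nonneg.2 hl.2)
    rw [← hlab]
    linarith
  have hhull : ∀ ρ ∈ Icc (0 : ℝ) 1,
      E0hull W ρ ≤ M + t * Es P m + t * tiltedEntropy P m * (ρ - m) := fun ρ hρ =>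
    csSup_le ⟨_, ρ, hρ, ρ, hρ, 1, by simp, by ring, rfl⟩ (hub ρ)
  have hattain : E0hull W m = M + t * Es P m := by
    refine IsGreatest.csSup_eq ⟨?_, fun z hz => by simpa using hub m z hz⟩
    -- If `ρ₁ = m` the contact point alone suffices, and `ρ₂ - ρ₁` might be zero; otherwise the
    -- chord between the contact points passes over `m`.
    rcases h₁m.eq_or_lt with h | h
    · exact ⟨ρ₁, h₁, ρ₁, h₁, 1, by simp, by rw [h]; ring, by rw [he₁, h]; ring⟩
    · have hpos : 0 < ρ₂ - ρ₁ := by linarith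
      refine ⟨ρ₁, h₁, ρ₂, h₂, (ρ₂ - m) / (ρ₂ - ρ₁), ⟨div_nonneg (by linarith) hpos.le,
        by rw [div_le_one hpos]; linarith⟩, by field_simp; ring, ?_⟩
      rw [he₁, he₂]
      field_simp
      ring
  refine ⟨⟨m, hm, by simp only [hattain]; ring⟩, ?_⟩
  rintro _ ⟨ρ, hρ, rfl⟩
  have h1 := hhull ρ hρ
  -- The line above the hull and the tangent below `t * Es` are parallel, at distance `M`.
  have h2 := mul_le_mul_of_nonneg_left (Es_tangent hP hm.1 hρ.1) ht.le
  simp only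
  linarith

end Hull

/-! ### Random coding with classes -/

section Ensemble

variable {M A : Type*} [Fintype M] [Fintype A]

variable {N : ℕ} {cls : M → Fin N} {q a : M → A → ℝ} {ρ : Fin N → ℝ}

/-- The expected sum of the tilted weights of class `i`. -/
noncomputable def classSum (cls : M → Fin N) (q a : M → A → ℝ) (ρ : Fin N → ℝ) (i : Fin N) : ℝ :=
  ∑ v, if cls v = i then ∑ x, q v x * a v x ^ (1 / (1 + ρ i)) else 0

lemma classSum_nonneg (hq : ∀ v, q v ∈ stdSimplex ℝ A) (ha : ∀ v x, 0 ≤ a v x) (i : Fin N) :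
    0 ≤ classSum cls q a ρ i := by
  refine Finset.sum_nonneg fun v _ => ?_
  split_ifs
  · exact Finset.sum_nonneg fun x _ => mul_nonneg ((hq v).1 x) (Real.rpow_nonneg (ha v x) _)
  · exact le_rfl

lemma sum_fiber_eq (F : M → ℝ) (cls : M → Fin N) :
    ∑ v, F v = ∑ i, ∑ v, if cls v = i then F v else 0 := by
  rw [Finset.sum_comm]
  simp

variable [DecidableEq M]

/-- Independence of the codewords: the sum over codebooks factors, and every factor other than that
of `v` is `1`. -/
lemma sum_prod_mul_apply {q : M → A → ℝ} (hq : ∀ v, ∑ x, q v x = 1) (v : M) (φ : A → ℝ) :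
    ∑ c : M → A, (∏ w, q w (c w)) * φ (c v) = ∑ x, q v x * φ x := by
  have h := Fintype.prod_sum fun (w : M) (x : A) => q w x * if w = v then φ x else 1
  have h1 : ∀ c : M → A, ∏ w, (q w (c w) * if w = v then φ (c w) else 1)
      = (∏ w, q w (c w)) * φ (c v) := by
    intro c
    rw [Finset.prod_mul_distrib, Finset.prod_ite_eq' Finset.univ v]
    simp
  simp_rw [h1] at h
  rw [← h, Finset.prod_eq_single v]
  · simp
  · intro w _ hw
    simp [hw, hq w]
  · simp

lemma sum_prod_mul_apply_mul_apply {q : M → A → ℝ} (hq : ∀ v, ∑ x, q v x = 1) {v v' : M}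
    (hv : v' ≠ v) (φ ψ : A → ℝ) :
    ∑ c : M → A, (∏ w, q w (c w)) * (φ (c v) * ψ (c v'))
      = (∑ x, q v x * φ x) * ∑ x, q v' x * ψ x := by
  have h := Fintype.prod_sum fun (w : M) (x : A) =>
    q w x * ((if w = v then φ x else 1) * if w = v' then ψ x else 1)
  have h1 : ∀ c : M → A,
      ∏ w, (q w (c w) * ((if w = v then φ (c w) else 1) * if w = v' then ψ (c w) else 1))
      = (∏ w, q w (c w)) * (φ (c v) * ψ (c v')) := by
    intro c
    rw [Finset.prod_mul_distrib, Finset.prod_mul_distrib, Finset.prod_ite_eq' Finset.univ v,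
      Finset.prod_ite_eq' Finset.univ v']
    simp
  simp_rw [h1] at h
  rw [← h, Finset.prod_eq_mul v v' hv.symm]
  · simp [hv, hv.symm]
  · rintro w _ ⟨hw, hw'⟩
    simp [hw, hw', hq w]
  · simp
  · simp

/-- A maximizing decision errs with at most the weight of the candidates that are rivalled
in a given metric. -/
lemma sum_error_le_of_metric {a G : M → ℝ} (ha : ∀ v, 0 ≤ a v) {d : M} (hd : ∀ v, a v ≤ a d)
    {b : M → ℝ} (hb : ∀ v, 0 ≤ b v) (hb1 : ∀ v v', v' ≠ v → G v ≤ G v' → 1 ≤ b v) :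
    ∑ v, (if d = v then 0 else a v) ≤ ∑ v, a v * b v := by
  have : Nonempty M := ⟨d⟩
  obtain ⟨d', hd'⟩ := Finite.exists_max G
  have h1 : ∀ e : M, ∑ v, (if e = v then 0 else a v) = ∑ v, a v - a e := by
    intro e
    have he : a e = ∑ v, if e = v then a v else 0 := by simp
    rw [eq_sub_iff_add_eq, he, ← Finset.sum_add_distrib]
    refine Finset.sum_congr rfl fun v _ => ?_
    split_ifs <;> simp
  -- The decision `d` is optimal for `a`, so it errs no more than the decision `d'` that maximizes
  -- the metric `G`.
  have h2 : ∑ v, (if d = v then 0 else a v) ≤ ∑ v, (if d' = v then 0 else a v) := by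
    rw [h1, h1]
    linarith [hd d']
  refine h2.trans (Finset.sum_le_sum fun v _ => ?_)
  split_ifs with h
  · exact mul_nonneg (ha v) (hb v)
  · exact le_mul_of_one_le_right (ha v) (hb1 v d' h (hd' v))

lemma min_one_le_rpow {z ρ : ℝ} (hz : 0 ≤ z) (hρ : ρ ∈ Icc (0 : ℝ) 1) :
    min 1 z ≤ z ^ ρ := by
  rcases le_total 1 z with h | h
  · exact (min_le_left _ _).trans (Real.one_le_rpow h hρ.1)
  · exact (min_le_right _ _).trans (Real.self_le_rpow_of_le_one hz h hρ.2)

/-- Random-coding bound for one channel output and an ensemble with classes. -/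
theorem ensemble_error_le (hq : ∀ v, q v ∈ stdSimplex ℝ A) (ha : ∀ v x, 0 ≤ a v x)
    (hρ : ∀ i, ρ i ∈ Icc (0 : ℝ) 1) {d : (M → A) → M}
    (hd : ∀ c v, a v (c v) ≤ a (d c) (c (d c))) :
    ∑ c : M → A, (∏ v, q v (c v)) * ∑ v, (if d c = v then 0 else a v (c v))
      ≤ N * ∑ i, classSum cls q a ρ i ^ (1 + ρ i) := by
  classical
  set f := classSum cls q a ρ with hf
  have hf0 : ∀ i, 0 ≤ f i := classSum_nonneg hq ha
  have hs : ∀ i, 0 < 1 + ρ i := fun i => by linarith [(hρ i).1]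
  -- Dividing by the class sum makes the metrics of different classes comparable: each class has
  -- expected total `f i / f i ≤ 1`, also when `f i = 0`.
  set G : M → A → ℝ := fun v x => a v x ^ (1 / (1 + ρ (cls v))) / f (cls v) with hG
  have hG0 : ∀ v x, 0 ≤ G v x := fun v x => div_nonneg (Real.rpow_nonneg (ha v x) _) (hf0 _)
  have hqs : ∀ v, ∑ x, q v x = 1 := fun v => (hq v).2
  have hprod : ∀ c : M → A, 0 ≤ ∏ v, q v (c v) := fun c =>
    Finset.prod_nonneg fun v _ => (hq v).1 _
  -- the rivals of all classes have an expected total metric of at most `N`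
  have hrival : ∀ v, ∑ v' ∈ Finset.univ.erase v, ∑ x, q v' x * G v' x ≤ N := by
    intro v
    have h1 : ∀ i, ∑ v', (if cls v' = i then ∑ x, q v' x * G v' x else 0) = f i / f i := by
      intro i
      conv_rhs => rw [hf, classSum, Finset.sum_div]
      refine Finset.sum_congr rfl fun v' _ => ?_
      split_ifs with h
      · rw [Finset.sum_div]
        refine Finset.sum_congr rfl fun x _ => ?_
        rw [hG]
        simp only [h, mul_div_assoc]
        rfl
      · simp
    calc ∑ v' ∈ Finset.univ.erase v, ∑ x, q v' x * G v' x
        ≤ ∑ v', ∑ x, q v' x * G v' x :=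
          Finset.sum_le_sum_of_subset_of_nonneg (Finset.erase_subset _ _) fun v' _ _ =>
            Finset.sum_nonneg fun x _ => mul_nonneg ((hq v').1 x) (hG0 v' x)
      _ = ∑ i, f i / f i := by rw [sum_fiber_eq _ cls]; exact Finset.sum_congr rfl fun i _ => h1 i
      _ ≤ ∑ _i : Fin N, (1 : ℝ) := Finset.sum_le_sum fun i _ => div_self_le_one _
      _ = N := by simp
  -- use the trivial bound or Markov's inequality, whichever is better
  set α : M → A → ℝ := fun v x => if G v x ≤ N then 1 else 0 with hα
  set β : M → A → ℝ := fun v x => if G v x ≤ N then 0 else 1 / G v x with hβ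
  have hα0 : ∀ v x, 0 ≤ α v x := fun v x => by simp only [hα]; split_ifs <;> norm_num
  have hβ0 : ∀ v x, 0 ≤ β v x := fun v x => by
    simp only [hβ]; split_ifs
    · exact le_rfl
    · exact div_nonneg zero_le_one (hG0 v x)
  set b : (M → A) → M → ℝ := fun c v =>
    α v (c v) + β v (c v) * ∑ v' ∈ Finset.univ.erase v, G v' (c v') with hb
  have hstep : ∀ c : M → A, ∑ v, (if d c = v then 0 else a v (c v)) ≤ ∑ v, a v (c v) * b c v := by
    intro c
    have hsum0 : ∀ v, 0 ≤ ∑ v' ∈ Finset.univ.erase v, G v' (c v') := fun v =>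
      Finset.sum_nonneg fun v' _ => hG0 v' _
    refine sum_error_le_of_metric (G := fun v => G v (c v)) (fun v => ha v _) (hd c)
      (fun v => add_nonneg (hα0 v _) (mul_nonneg (hβ0 v _) (hsum0 v))) fun v v' hv hle => ?_
    by_cases h : G v (c v) ≤ N
    · simp [hb, hα, hβ, h]
    · have hpos : 0 < G v (c v) := (Nat.cast_nonneg N).trans_lt (not_le.1 h)
      have h1 : G v' (c v') ≤ ∑ v' ∈ Finset.univ.erase v, G v' (c v') :=
        Finset.single_le_sum (f := fun v' => G v' (c v')) (fun v' _ => hG0 v' _)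
          (Finset.mem_erase.2 ⟨hv, Finset.mem_univ _⟩)
      simp only [hb, hα, hβ, h, if_false, zero_add]
      rw [one_div_mul_eq_div, one_le_div hpos]
      exact hle.trans h1
  -- The bracket is `min 1 (N / G) ≤ (N / G) ^ ρ`. Since `1 / (1 + ρ) + ρ / (1 + ρ) = 1`, the powers
  -- of `a` combine to `a ^ (1 / (1 + ρ))`; finally `N ^ ρ ≤ N`. Zero weights are treated apart, as
  -- `f` or `G` may vanish there.
  have hterm : ∀ v x, q v x * (a v x * (α v x + β v x * N))
      ≤ N * (q v x * a v x ^ (1 / (1 + ρ (cls v))) * f (cls v) ^ ρ (cls v)) := by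
    intro v x
    have hN : (1 : ℝ) ≤ N := by
      exact_mod_cast (Nat.one_le_iff_ne_zero.2 fun h => by subst h; exact (cls v).elim0)
    have hrhs : 0 ≤ N * (q v x * a v x ^ (1 / (1 + ρ (cls v))) * f (cls v) ^ ρ (cls v)) :=
      mul_nonneg (Nat.cast_nonneg N) (mul_nonneg (mul_nonneg ((hq v).1 x)
        (Real.rpow_nonneg (ha v x) _)) (Real.rpow_nonneg (hf0 _) _))
    rcases ((hq v).1 x).eq_or_lt with h | hqx
    · simp [← h]
    rcases (ha v x).eq_or_lt with h | hax
    · rw [← h] at hrhs ⊢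
      simpa using hrhs
    set i := cls v with hi
    have hpow : 0 < a v x ^ (1 / (1 + ρ i)) := Real.rpow_pos_of_pos hax _
    have hfi : 0 < f i := by
      have h1 : q v x * a v x ^ (1 / (1 + ρ i)) ≤ f i := by
        calc q v x * a v x ^ (1 / (1 + ρ i))
            ≤ ∑ x, q v x * a v x ^ (1 / (1 + ρ i)) :=
              Finset.single_le_sum (f := fun x => q v x * a v x ^ (1 / (1 + ρ i)))
                (fun x _ => mul_nonneg ((hq v).1 x) (Real.rpow_nonneg (ha v x) _))
                (Finset.mem_univ x)
          _ = if cls v = i then ∑ x, q v x * a v x ^ (1 / (1 + ρ i)) else 0 := by simp [hi]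
          _ ≤ f i := by
              refine Finset.single_le_sum (f := fun v => if cls v = i then
                ∑ x, q v x * a v x ^ (1 / (1 + ρ i)) else 0) (fun v _ => ?_) (Finset.mem_univ v)
              split_ifs
              · exact Finset.sum_nonneg fun x _ =>
                  mul_nonneg ((hq v).1 x) (Real.rpow_nonneg (ha v x) _)
              · exact le_rfl
      exact (mul_pos hqx hpow).trans_le h1
    have hGpos : 0 < G v x := div_pos hpow hfi
    have h1 : α v x + β v x * N = min 1 (N / G v x) := by
      simp only [hα, hβ]
      split_ifs with h
      · rw [min_eq_left ((one_le_div hGpos).2 h)]; ring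
      · rw [min_eq_right ((div_le_one hGpos).2 (not_le.1 h).le)]; ring
    have h2 : a v x * (N / G v x) ^ ρ i ≤ N * (a v x ^ (1 / (1 + ρ i)) * f i ^ ρ i) := by
      have e : (N : ℝ) / G v x = N * (f i / a v x ^ (1 / (1 + ρ i))) := by
        rw [hG]; simp only; rw [div_div_eq_mul_div, mul_div_assoc]
      have e2 : a v x * (1 / (a v x ^ (1 / (1 + ρ i))) ^ ρ i) = a v x ^ (1 / (1 + ρ i)) := by
        rw [← Real.rpow_mul hax.le, mul_one_div, div_eq_iff (Real.rpow_pos_of_pos hax _).ne',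
          ← Real.rpow_add hax]
        have : 1 / (1 + ρ i) + 1 / (1 + ρ i) * ρ i = 1 := by
          have := (hs i).ne'
          field_simp
        rw [this, Real.rpow_one]
      rw [e, Real.mul_rpow (by positivity) (by positivity), Real.div_rpow hfi.le hpow.le]
      calc a v x * ((N : ℝ) ^ ρ i * (f i ^ ρ i / (a v x ^ (1 / (1 + ρ i))) ^ ρ i))
          = (N : ℝ) ^ ρ i * ((a v x * (1 / (a v x ^ (1 / (1 + ρ i))) ^ ρ i)) * f i ^ ρ i) := by
            ring
        _ ≤ N * (a v x ^ (1 / (1 + ρ i)) * f i ^ ρ i) := by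
            rw [e2]
            refine mul_le_mul_of_nonneg_right ?_ (by positivity)
            calc (N : ℝ) ^ ρ i ≤ (N : ℝ) ^ (1 : ℝ) := Real.rpow_le_rpow_of_exponent_le hN (hρ i).2
              _ = N := Real.rpow_one _
    calc q v x * (a v x * (α v x + β v x * N))
        ≤ q v x * (a v x * (N / G v x) ^ ρ i) := by
          rw [h1]
          exact mul_le_mul_of_nonneg_left (mul_le_mul_of_nonneg_left
            (min_one_le_rpow (by positivity) (hρ i)) hax.le) hqx.le
      _ ≤ q v x * (N * (a v x ^ (1 / (1 + ρ i)) * f i ^ ρ i)) :=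
          mul_le_mul_of_nonneg_left h2 hqx.le
      _ = _ := by ring
  -- `α` and `β` depend only on the codeword of `v`, hence are independent of each rival's metric.
  have hexp : ∀ v, ∑ c : M → A, (∏ w, q w (c w)) * (a v (c v) * b c v)
      ≤ ∑ x, q v x * (a v x * (α v x + β v x * N)) := by
    intro v
    have e : ∀ c : M → A, (∏ w, q w (c w)) * (a v (c v) * b c v)
        = (∏ w, q w (c w)) * (a v (c v) * α v (c v))
          + ∑ v' ∈ Finset.univ.erase v,
            (∏ w, q w (c w)) * ((a v (c v) * β v (c v)) * G v' (c v')) := by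
      intro c
      simp only [hb]
      rw [← Finset.mul_sum, ← Finset.mul_sum]
      ring
    simp_rw [e]
    rw [Finset.sum_add_distrib, Finset.sum_comm,
      sum_prod_mul_apply hqs v fun x => a v x * α v x,
      Finset.sum_congr rfl fun v' hv' => sum_prod_mul_apply_mul_apply hqs
        (Finset.ne_of_mem_erase hv') (fun x => a v x * β v x) (G v'), ← Finset.mul_sum]
    have h1 := mul_le_mul_of_nonneg_left (hrival v)
      (Finset.sum_nonneg fun x _ => mul_nonneg ((hq v).1 x) (mul_nonneg (ha v x) (hβ0 v x)) :
        0 ≤ ∑ x, q v x * (a v x * β v x))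
    refine (add_le_add le_rfl h1).trans_eq ?_
    rw [Finset.sum_mul, ← Finset.sum_add_distrib]
    exact Finset.sum_congr rfl fun x _ => by ring
  calc ∑ c : M → A, (∏ v, q v (c v)) * ∑ v, (if d c = v then 0 else a v (c v))
      ≤ ∑ c : M → A, (∏ v, q v (c v)) * ∑ v, a v (c v) * b c v :=
        Finset.sum_le_sum fun c _ => mul_le_mul_of_nonneg_left (hstep c) (hprod c)
    _ = ∑ v, ∑ c : M → A, (∏ w, q w (c w)) * (a v (c v) * b c v) := by
        rw [Finset.sum_comm]
        exact Finset.sum_congr rfl fun c _ => Finset.mul_sum _ _ _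
    _ ≤ ∑ v, ∑ x, N * (q v x * a v x ^ (1 / (1 + ρ (cls v))) * f (cls v) ^ ρ (cls v)) :=
        Finset.sum_le_sum fun v _ => (hexp v).trans (Finset.sum_le_sum fun x _ => hterm v x)
    _ = N * ∑ i, f i ^ (1 + ρ i) := by
        simp_rw [← Finset.mul_sum, ← Finset.sum_mul]
        rw [sum_fiber_eq _ cls]
        congr 1
        refine Finset.sum_congr rfl fun i _ => ?_
        rw [Real.rpow_one_add' (hf0 i) (hs i).ne']
        conv_rhs => enter [1]; rw [hf, classSum]
        rw [Finset.sum_mul]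
        refine Finset.sum_congr rfl fun v _ => ?_
        split_ifs with h
        · rw [h]
        · simp

end Ensemble

/-! ### Memoryless sources and channels -/

lemma sum_iidProb {A : Type*} [Fintype A] (p : A → ℝ) (m : ℕ) :
    ∑ a : Fin m → A, iidProb p a = (∑ x, p x) ^ m := by
  have h := Fintype.prod_sum fun (_ : Fin m) (x : A) => p x
  simp only [iidProb]
  rw [← h]
  simp

lemma iidProb_mem {A : Type*} [Fintype A] {p : A → ℝ} (hp : p ∈ stdSimplex ℝ A) (m : ℕ) :
    (iidProb p : (Fin m → A) → ℝ) ∈ stdSimplex ℝ (Fin m → A) :=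
  ⟨fun a => Finset.prod_nonneg fun j _ => hp.1 (a j), by rw [sum_iidProb, hp.2, one_pow]⟩

lemma iidProb_rpow {A : Type*} {p : A → ℝ} (hp : ∀ x, 0 ≤ p x) (s : ℝ) {m : ℕ} (a : Fin m → A) :
    iidProb p a ^ s = iidProb (fun x => p x ^ s) a :=
  (Real.finsetProd_rpow _ _ (fun j _ => hp (a j)) s).symm

lemma channelProb_nonneg {X Y : Type*} [Fintype Y] {W : X → Y → ℝ}
    (hW : ∀ x, W x ∈ stdSimplex ℝ Y) {n : ℕ}
    (x : Fin n → X) (y : Fin n → Y) : 0 ≤ channelProb W x y :=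
  Finset.prod_nonneg fun j _ => (hW (x j)).1 (y j)

section Bound

variable {V X Y : Type*} [Fintype V] [DecidableEq V] [Nonempty V] [Fintype X] [Fintype Y]
  {P : V → ℝ} {W : X → Y → ℝ} {N k : ℕ} {cls : (Fin k → V) → Fin N} {Q : Fin N → X → ℝ}
  {ρ : Fin N → ℝ}

/-- Single-letterization: the average over codewords splits into one factor for each channel use. -/
lemma sum_iidProb_mul_channelProb_rpow (hW : ∀ x, W x ∈ stdSimplex ℝ Y) (q : X → ℝ) (s : ℝ)
    {n : ℕ} (y : Fin n → Y) :
    ∑ x, iidProb q x * channelProb W x y ^ s = ∏ j, ∑ x, q x * W x (y j) ^ s := by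
  rw [Fintype.prod_sum fun (j : Fin n) (x : X) => q x * W x (y j) ^ s]
  refine Finset.sum_congr rfl fun x _ => ?_
  rw [Finset.prod_mul_distrib, iidProb, channelProb,
    Real.finsetProd_rpow _ _ fun j _ => (hW (x j)).1 (y j)]

/-- Gallager's bound for an ensemble with classes: every class contributes with a parameter of
its own. -/
theorem ensembleErrorProb_le (hP : P ∈ stdSimplex ℝ V) (hW : ∀ x, W x ∈ stdSimplex ℝ Y)
    (hQ : ∀ i, Q i ∈ stdSimplex ℝ X) (hρ : ∀ i, ρ i ∈ Icc (0 : ℝ) 1) (n : ℕ) :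
    ensembleErrorProb n P W cls Q
      ≤ N * ∑ i, (∑ v, if cls v = i then iidProb P v ^ (1 / (1 + ρ i)) else 0) ^ (1 + ρ i)
        * gallagerSum W (Q i) (ρ i) ^ n := by
  have h1 : ensembleErrorProb n P W cls Q = ∑ y : Fin n → Y, ∑ c : Codebook V X k n,
      (∏ v, iidProb (Q (cls v)) (c v)) *
        ∑ v, if mapDecoder P W c y = v then 0 else iidProb P v * channelProb W (c v) y := by
    rw [Finset.sum_comm, ensembleErrorProb]
    refine Finset.sum_congr rfl fun c _ => ?_
    rw [errorProb, ← Finset.mul_sum]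
    congr 1
    exact Finset.sum_comm
  have h2 : ∀ (y : Fin n → Y) (i : Fin N),
      classSum cls (fun v => iidProb (Q (cls v))) (fun v x => iidProb P v * channelProb W x y) ρ i
        ^ (1 + ρ i)
      = (∑ v, if cls v = i then iidProb P v ^ (1 / (1 + ρ i)) else 0) ^ (1 + ρ i)
        * ∏ j, (∑ x, Q i x * W x (y j) ^ (1 / (1 + ρ i))) ^ (1 + ρ i) := by
    intro y i
    rw [Real.finsetProd_rpow _ _ fun j _ => inner_sum_nonneg hW (hQ i) _ (y j),
      ← Real.mul_rpow]
    · rw [classSum, Finset.sum_mul]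
      congr 1
      refine Finset.sum_congr rfl fun v _ => ?_
      split_ifs with h
      · rw [← sum_iidProb_mul_channelProb_rpow hW, Finset.mul_sum]
        refine Finset.sum_congr rfl fun x _ => ?_
        rw [h, Real.mul_rpow ((iidProb_mem hP k).1 v) (channelProb_nonneg hW x y)]
        ring
      · simp
    · refine Finset.sum_nonneg fun v _ => ?_
      split_ifs
      · exact Real.rpow_nonneg ((iidProb_mem hP k).1 v) _
      · exact le_rfl
    · exact Finset.prod_nonneg fun j _ => inner_sum_nonneg hW (hQ i) _ (y j)
  rw [h1]
  calc _ ≤ ∑ y : Fin n → Y, N * ∑ i, classSum cls (fun v => iidProb (Q (cls v)))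
          (fun v x => iidProb P v * channelProb W x y) ρ i ^ (1 + ρ i) :=
        Finset.sum_le_sum fun y _ => ensemble_error_le (fun v => iidProb_mem (hQ (cls v)) n)
          (fun v x => mul_nonneg ((iidProb_mem hP k).1 v) (channelProb_nonneg hW x y)) hρ
          (d := fun c => mapDecoder P W c y) fun c v =>
            Classical.choose_spec (Finite.exists_max fun v : Fin k → V =>
              iidProb P v * channelProb W (c v) y) v
    _ = _ := by
        rw [← Finset.mul_sum, Finset.sum_comm]
        congr 1
        refine Finset.sum_congr rfl fun i _ => ?_
        rw [Finset.sum_congr rfl fun y _ => h2 y i, ← Finset.mul_sum, gallagerSum,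
          ← sum_iidProb]
        rfl

end Bound

/-- The contribution of a class cut out by a threshold on the message probabilities. -/
lemma class_partitionSum_le {V : Type*} [Fintype V] {P : V → ℝ} (hP : P ∈ stdSimplex ℝ V)
    {m r : ℝ} (hm : 0 ≤ m) (hr : 0 ≤ r) {k : ℕ} (p : (Fin k → V) → Prop) [DecidablePred p]
    (hp : ∀ v, p v → (iidProb P v ≤ Real.exp (k * tiltedLog P m) ∧ r ≤ m) ∨
      (Real.exp (k * tiltedLog P m) ≤ iidProb P v ∧ m ≤ r)) :
    (∑ v, if p v then iidProb P v ^ (1 / (1 + r)) else 0) ^ (1 + r)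
      ≤ Real.exp (k * (Es P m + (r - m) * tiltedEntropy P m)) := by
  have hm' : 0 < 1 + m := by linarith
  have hr' : 0 < 1 + r := by linarith
  set s := 1 / (1 + r) with hs
  set u := 1 / (1 + m) with hu
  have hs0 : 0 < s := by positivity
  have hu0 : 0 < u := by positivity
  set B := Real.exp (k * tiltedLog P m) with hB
  have hB0 : 0 < B := Real.exp_pos _
  -- The exponent is moved from `1 / (1 + r)` to `1 / (1 + m)`. The sign of `s - u` is that of `m -
  -- r`, so on either side of the threshold the surplus power is at most `B ^ (s - u)`. The sum may
  -- then run over all messages and factors.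
  have hterm : ∀ v, (if p v then iidProb P v ^ s else 0) ≤ B ^ (s - u) * iidProb P v ^ u := by
    intro v
    have hnn := (iidProb_mem hP k).1 v
    split_ifs with h
    · rcases hnn.eq_or_lt with h0 | h0
      · rw [← h0, Real.zero_rpow hs0.ne', Real.zero_rpow hu0.ne', mul_zero]
      · have e : iidProb P v ^ s = iidProb P v ^ (s - u) * iidProb P v ^ u := by
          rw [← Real.rpow_add h0, sub_add_cancel]
        rw [e]
        refine mul_le_mul_of_nonneg_right ?_ (Real.rpow_nonneg hnn _)
        rcases hp v h with ⟨h1, h2⟩ | ⟨h1, h2⟩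
        · exact Real.rpow_le_rpow hnn h1
            (sub_nonneg.2 (one_div_le_one_div_of_le hr' (by linarith)))
        · exact Real.rpow_le_rpow_of_nonpos hB0 h1
            (sub_nonpos.2 (one_div_le_one_div_of_le hm' (by linarith)))
    · exact mul_nonneg (Real.rpow_nonneg hB0.le _) (Real.rpow_nonneg hnn _)
  have hZ := partitionSum_pos hP m
  have hsum : ∑ v, (if p v then iidProb P v ^ s else 0)
      ≤ Real.exp (k * (tiltedLog P m * (s - u) + Real.log (partitionSum P m))) := by
    refine (Finset.sum_le_sum fun v _ => hterm v).trans_eq ?_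
    rw [← Finset.mul_sum, Finset.sum_congr rfl fun v _ => iidProb_rpow hP.1 u v, sum_iidProb,
      mul_add, Real.exp_add, hB, ← Real.exp_mul, Real.exp_nat_mul (Real.log _),
      Real.exp_log hZ, mul_assoc]
    rfl
  have hnonneg : 0 ≤ ∑ v, (if p v then iidProb P v ^ s else 0) := by
    refine Finset.sum_nonneg fun v _ => ?_
    split_ifs
    · exact Real.rpow_nonneg ((iidProb_mem hP k).1 v) _
    · exact le_rfl
  refine (Real.rpow_le_rpow hnonneg hsum hr'.le).trans_eq ?_
  rw [← Real.exp_mul]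
  congr 1
  have hL : Real.log (partitionSum P m) = Es P m * u := by
    rw [Es_eq hP, hu]; field_simp
  -- With the threshold at `tiltedLog P m`, the exponent becomes the tangent of `Es` at `m`,
  -- evaluated at `r`.
  have hT : tiltedLog P m = Es P m - (1 + m) * tiltedEntropy P m := by
    rw [Es_eq_tilted hP hm]; ring
  rw [hL, hT, hs, hu]
  field_simp
  ring

/-! ### Minimizing over the rate -/

/-- This isolates the extended-real arithmetic: a finite bound on all pairs makes the first supremum
finite, so it can be moved to the other side. -/
lemma mul_iSup_add_iSup_le_iff {A B : Set ℝ} (hA : A.Nonempty) (hB : B.Nonempty) {f g : ℝ → ℝ}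
    {t c : ℝ} (ht : 0 < t) :
    (t : EReal) * (⨆ i ∈ A, ((f i : ℝ) : EReal)) + (⨆ j ∈ B, ((g j : ℝ) : EReal)) ≤ (c : EReal)
      ↔ ∀ i ∈ A, ∀ j ∈ B, t * f i + g j ≤ c := by
  constructor
  · intro h i hi j hj
    have h1 : ((f i : ℝ) : EReal) ≤ ⨆ i ∈ A, ((f i : ℝ) : EReal) :=
      le_iSup₂ (f := fun i (_ : i ∈ A) => ((f i : ℝ) : EReal)) i hi
    have h2 : ((g j : ℝ) : EReal) ≤ ⨆ j ∈ B, ((g j : ℝ) : EReal) :=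
      le_iSup₂ (f := fun j (_ : j ∈ B) => ((g j : ℝ) : EReal)) j hj
    have h3 := (add_le_add (mul_le_mul_of_nonneg_left h1
      (EReal.coe_nonneg.2 ht.le)) h2).trans h
    exact_mod_cast h3
  · intro h
    obtain ⟨i₀, hi₀⟩ := hA
    have hle : ∀ j ∈ B, (⨆ i ∈ A, ((f i : ℝ) : EReal)) ≤ (((c - g j) / t : ℝ) : EReal) :=
      fun j hj => iSup₂_le fun i hi => by
        rw [EReal.coe_le_coe_iff, le_div_iff₀ ht]
        linarith [h i hi j hj]
    have hge : ((f i₀ : ℝ) : EReal) ≤ ⨆ i ∈ A, ((f i : ℝ) : EReal) :=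
      le_iSup₂ (f := fun i (_ : i ∈ A) => ((f i : ℝ) : EReal)) i₀ hi₀
    obtain ⟨j₀, hj₀⟩ := hB
    have hlift : ∃ a : ℝ, (a : EReal) = ⨆ i ∈ A, ((f i : ℝ) : EReal) :=
      ⟨_, EReal.coe_toReal ((hle j₀ hj₀).trans_lt (EReal.coe_lt_top _)).ne
        ((EReal.bot_lt_coe _).trans_le hge).ne'⟩
    obtain ⟨a, ha⟩ := hlift
    rw [← ha] at hle ⊢
    have hg : (⨆ j ∈ B, ((g j : ℝ) : EReal)) ≤ ((c - t * a : ℝ) : EReal) :=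
      iSup₂_le fun j hj => by
        have h1 := EReal.coe_le_coe_iff.1 (hle j hj)
        rw [le_div_iff₀ ht] at h1
        rw [EReal.coe_le_coe_iff]
        linarith
    refine (add_le_add le_rfl hg).trans_eq ?_
    rw [← EReal.coe_mul, ← EReal.coe_add]
    congr 1
    ring

section Exponents

variable {V X Y : Type*} [Fintype V] [Fintype X] [Fintype Y] {P : V → ℝ} {W : X → Y → ℝ} {t : ℝ}

/-- The conditions are affine in `R`; this is the form in which convexity of the objective is used.
-/
lemma csiszarObjective_le_iff (ht : 0 < t) {R c : ℝ} :
    csiszarObjective P W t R ≤ (c : EReal) ↔ ∀ σ ∈ Ici (0 : ℝ), ∀ ρ ∈ Icc (0 : ℝ) 1,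
      σ * R - t * Es P σ + (E0max W ρ - ρ * R) ≤ c := by
  rw [csiszarObjective, sourceExponent, randomCodingExponent,
    mul_iSup_add_iSup_le_iff (A := Ici 0) nonempty_Ici ⟨0, by simp⟩ ht]
  have e : ∀ σ, t * (σ * (R / t) - Es P σ) = σ * R - t * Es P σ := fun σ => by field_simp
  simp_rw [e]

lemma randomCodingExponent_le_spherePackingExponent (R : ℝ) :
    randomCodingExponent W R ≤ spherePackingExponent W R :=
  biSup_mono fun _ h => h.1

lemma csiszarObjective_le_spherePackingObjective (R : ℝ) :
    csiszarObjective P W t R ≤ spherePackingObjective P W t R :=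
  add_le_add le_rfl (randomCodingExponent_le_spherePackingExponent R)

lemma objectives_eq {R : ℝ} (h : randomCodingExponent W R = spherePackingExponent W R) :
    csiszarObjective P W t R = spherePackingObjective P W t R := by
  rw [csiszarObjective, spherePackingObjective, h]

lemma csiszarExponent_le_jointSpherePackingExponent :
    csiszarExponent P W t ≤ jointSpherePackingExponent P W t :=
  iInf₂_mono fun R _ => csiszarObjective_le_spherePackingObjective R

/-- Once the random-coding and the sphere-packing exponent coincide, they coincide at all larger
rates. -/
lemma exponents_eq_of_le (hW : ∀ x, W x ∈ stdSimplex ℝ Y) {R₀ R : ℝ} (hR : R₀ ≤ R)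
    (h : randomCodingExponent W R₀ = spherePackingExponent W R₀) :
    randomCodingExponent W R = spherePackingExponent W R := by
  refine (randomCodingExponent_le_spherePackingExponent R).antisymm ?_
  have hc : ContinuousOn (fun ρ => E0max W ρ - ρ * R₀) (Icc (0 : ℝ) 1) :=
    ((continuousOn_E0max hW).mono fun ρ hρ => hρ.1).sub (by fun_prop)
  obtain ⟨r, hr, hmax⟩ := isCompact_Icc.exists_isMaxOn ⟨0, by simp⟩ hc
  have h1 : randomCodingExponent W R₀ ≤ ((E0max W r - r * R₀ : ℝ) : EReal) :=
    iSup₂_le fun ρ hρ => EReal.coe_le_coe_iff.2 (hmax hρ)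
  refine iSup₂_le fun ρ hρ => ?_
  rcases le_total ρ 1 with hρ1 | hρ1
  · exact le_iSup₂ (f := fun ρ (_ : ρ ∈ Icc (0 : ℝ) 1) => ((E0max W ρ - ρ * R : ℝ) : EReal))
      ρ ⟨hρ, hρ1⟩
  -- The maximizer `r ≤ 1` at `R₀` beats `ρ ≥ 1` there, and raising the rate penalizes `ρ` at least
  -- as much as `r`.
  · refine le_trans ?_ (le_iSup₂ (f := fun ρ (_ : ρ ∈ Icc (0 : ℝ) 1) =>
      ((E0max W ρ - ρ * R : ℝ) : EReal)) r hr)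
    have h2 : ((E0max W ρ - ρ * R₀ : ℝ) : EReal) ≤ spherePackingExponent W R₀ :=
      le_iSup₂ (f := fun ρ (_ : ρ ∈ Ici (0 : ℝ)) => ((E0max W ρ - ρ * R₀ : ℝ) : EReal)) ρ hρ
    have h3 := EReal.coe_le_coe_iff.1 (h2.trans (h ▸ h1))
    rw [EReal.coe_le_coe_iff]
    nlinarith [hr.2]

/-- At rate `log |Y|` both suprema are attained at `ρ = 0`. Thus the critical rate is an infimum of
a nonempty set. -/
lemma exists_exponents_eq [Nonempty X] (hW : ∀ x, W x ∈ stdSimplex ℝ Y) :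
    {R : ℝ | 0 ≤ R ∧ randomCodingExponent W R = spherePackingExponent W R}.Nonempty := by
  refine ⟨Real.log (Fintype.card Y), Real.log_natCast_nonneg _,
    (randomCodingExponent_le_spherePackingExponent _).antisymm (iSup₂_le fun ρ hρ => ?_)⟩
  refine le_trans ?_ (le_iSup₂ (f := fun ρ (_ : ρ ∈ Icc (0 : ℝ) 1) =>
    ((E0max W ρ - ρ * Real.log (Fintype.card Y) : ℝ) : EReal)) 0 (by simp))
  rw [EReal.coe_le_coe_iff, E0max_zero hW]
  have := E0max_le hW (hρ : (0 : ℝ) ≤ ρ)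
  linarith

/-- The rate singled out by the supporting line is admissible. -/
lemma mem_rateRange (hP : P ∈ stdSimplex ℝ V) (ht : 0 < t) {m : ℝ} (hm : 0 ≤ m) :
    t * tiltedEntropy P m ∈ rateRange P t :=
  ⟨mul_le_mul_of_nonneg_left (tiltedEntropy_ge hP hm) ht.le,
    mul_le_mul_of_nonneg_left (tiltedEntropy_le hP m) ht.le⟩

/-- A supporting line identifies Csiszár's exponent. -/
lemma csiszarExponent_eq_of_supporting_line (hP : P ∈ stdSimplex ℝ V) {m ρ₁ ρ₂ M : ℝ}
    (ht : 0 < t) (hm : m ∈ Icc (0 : ℝ) 1) (h₁ : ρ₁ ∈ Icc (0 : ℝ) 1) (h₂ : ρ₂ ∈ Icc (0 : ℝ) 1)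
    (h₁m : ρ₁ ≤ m) (hm₂ : m ≤ ρ₂)
    (hle : ∀ ρ ∈ Icc (0 : ℝ) 1,
      E0max W ρ ≤ M + t * Es P m + t * tiltedEntropy P m * (ρ - m))
    (he₁ : E0max W ρ₁ = M + t * Es P m + t * tiltedEntropy P m * (ρ₁ - m))
    (he₂ : E0max W ρ₂ = M + t * Es P m + t * tiltedEntropy P m * (ρ₂ - m)) :
    csiszarExponent P W t = (M : EReal) := by
  apply le_antisymm
  · refine (iInf₂_le _ (mem_rateRange hP ht hm.1)).trans
      ((csiszarObjective_le_iff ht).2 fun σ hσ ρ hρ => ?_)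
    have h1 := hle ρ hρ
    have h2 := mul_le_mul_of_nonneg_left (Es_tangent hP hm.1 hσ) ht.le
    linarith
  · refine le_iInf₂ fun R _ => le_of_not_gt fun hlt => ?_
    obtain ⟨c, hc, hcM⟩ := EReal.lt_iff_exists_real_btwn.1 hlt
    have hcM' := EReal.coe_lt_coe_iff.1 hcM
    have h := (csiszarObjective_le_iff ht).1 hc.le m hm.1
    have ha := h ρ₁ h₁
    have hb := h ρ₂ h₂
    rw [he₁] at ha
    rw [he₂] at hb
    -- Pairing `m` with `ρᵢ` gives `M + (t * tiltedEntropy P m - R) * (ρᵢ - m)`; below the optimal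
    -- rate `ρ₂` makes the product nonnegative, above it `ρ₁` does.
    rcases le_total R (t * tiltedEntropy P m) with hR | hR
    · nlinarith [mul_nonneg (sub_nonneg.2 hR) (sub_nonneg.2 hm₂)]
    · nlinarith [mul_nonneg (sub_nonneg.2 hR) (sub_nonneg.2 h₁m)]

lemma exponents_agree_of_isMinOn_csiszarObjective {R : ℝ} (hR : R ∈ rateRange P t)
    (hmin : IsMinOn (csiszarObjective P W t) (rateRange P t) R)
    (h : randomCodingExponent W R = spherePackingExponent W R) :
    csiszarExponent P W t = jointSpherePackingExponent P W t := by
  refine csiszarExponent_le_jointSpherePackingExponent.antisymm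
    ((iInf₂_le R hR).trans ?_)
  rw [← objectives_eq h]
  exact le_iInf₂ fun R' hR' => hmin hR'

/-- Above some `R₀ < R` the two objectives coincide, so a smaller Csiszár value could occur only at
a rate below `R₀`. By convexity the value at `R₀` would then also be below that at `R`,
contradicting minimality. -/
lemma exponents_agree_of_isMinOn_spherePackingObjective [Nonempty X]
    (hW : ∀ x, W x ∈ stdSimplex ℝ Y) (ht : 0 < t) {R : ℝ} (hR : R ∈ rateRange P t)
    (hmin : IsMinOn (spherePackingObjective P W t) (rateRange P t) R)
    (hfin : spherePackingObjective P W t R ≠ ⊤) (hcr : criticalRate W < R) :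
    csiszarExponent P W t = jointSpherePackingExponent P W t := by
  refine csiszarExponent_le_jointSpherePackingExponent.antisymm
    ((iInf₂_le R hR).trans (le_iInf₂ fun R' hR' => le_of_not_gt fun hlt => ?_))
  obtain ⟨R₀, ⟨-, hR₀⟩, hR₀R⟩ := exists_lt_of_csInf_lt (exists_exponents_eq hW) hcr
  rcases le_total R₀ R' with hle | hle
  · rw [objectives_eq (exponents_eq_of_le hW hle hR₀)] at hlt
    exact absurd (hmin hR') (not_le.2 hlt)
  obtain ⟨c, hc, hcS⟩ := EReal.lt_iff_exists_real_btwn.1 hlt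
  have hlift : ∃ r : ℝ, (r : EReal) = spherePackingObjective P W t R :=
    ⟨_, EReal.coe_toReal hfin ((EReal.bot_lt_coe c).trans hcS).ne'⟩
  obtain ⟨r, hr⟩ := hlift
  rw [← hr] at hcS
  have hcr' := EReal.coe_lt_coe_iff.1 hcS
  have hC := (csiszarObjective_le_iff (P := P) (W := W) ht).1 hc.le
  have hCR := (csiszarObjective_le_iff (P := P) (W := W) ht).1
    ((csiszarObjective_le_spherePackingObjective R).trans hr.ge)
  have hpos : 0 < R - R' := by linarith
  -- the convex Csiszár objective would be too small at `R₀`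
  set w := (R - R₀) / (R - R') with hw
  have hw0 : 0 < w := div_pos (by linarith) hpos
  have hw1 : w ≤ 1 := (div_le_one hpos).2 (by linarith)
  have hR₀eq : R₀ = w * R' + (1 - w) * R := by
    have : w * (R - R') = R - R₀ := by rw [hw]; field_simp
    linarith
  have hobj : csiszarObjective P W t R₀ ≤ ((w * c + (1 - w) * r : ℝ) : EReal) := by
    refine (csiszarObjective_le_iff ht).2 fun σ hσ ρ hρ => ?_
    have h1 := mul_le_mul_of_nonneg_left (hC σ hσ ρ hρ) hw0.le
    have h2 := mul_le_mul_of_nonneg_left (hCR σ hσ ρ hρ) (sub_nonneg.2 hw1)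
    rw [hR₀eq]
    linarith
  have hmem : R₀ ∈ rateRange P t := ⟨hR'.1.trans hle, hR₀R.le.trans hR.2⟩
  have h3 : spherePackingObjective P W t R ≤ spherePackingObjective P W t R₀ := hmin hmem
  rw [← hr, ← objectives_eq hR₀] at h3
  have h4 := EReal.coe_le_coe_iff.1 (h3.trans hobj)
  nlinarith

end Exponents

/-! ### Two classes attain the exponent -/

lemma exists_errorProb_le {V X Y : Type*} [Fintype V] [DecidableEq V] [Nonempty V] [Fintype X]
    [Fintype Y] {N k n : ℕ} {P : V → ℝ} {W : X → Y → ℝ} {cls : (Fin k → V) → Fin N}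
    {Q : Fin N → X → ℝ} (hQ : ∀ i, Q i ∈ stdSimplex ℝ X) {B : ℝ}
    (h : ensembleErrorProb n P W cls Q ≤ B) : ∃ c : Codebook V X k n, errorProb P W c ≤ B := by
  by_contra! hlt
  have hsum : ∑ c : Codebook V X k n, ∏ v, iidProb (Q (cls v)) (c v) = 1 := by
    rw [← Fintype.prod_sum fun (v : Fin k → V) (x : Fin n → X) => iidProb (Q (cls v)) x]
    exact Finset.prod_eq_one fun v _ => (iidProb_mem (hQ _) n).2
  have hnn : ∀ c : Codebook V X k n, 0 ≤ ∏ v, iidProb (Q (cls v)) (c v) := fun c =>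
    Finset.prod_nonneg fun v _ => (iidProb_mem (hQ _) n).1 _
  have hpos : ∃ c : Codebook V X k n, 0 < ∏ v, iidProb (Q (cls v)) (c v) :=
    exists_pos_of_mem_stdSimplex ⟨hnn, hsum⟩
  obtain ⟨c₀, hc₀⟩ := hpos
  have : B < ensembleErrorProb n P W cls Q := by
    calc B = ∑ c : Codebook V X k n, (∏ v, iidProb (Q (cls v)) (c v)) * B := by
          rw [← Finset.sum_mul, hsum, one_mul]
      _ < _ := Finset.sum_lt_sum
          (fun c _ => mul_le_mul_of_nonneg_left (hlt c).le (hnn c))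
          ⟨c₀, Finset.mem_univ _, mul_lt_mul_of_pos_left (hlt c₀) hc₀⟩
  exact absurd h (not_le.2 this)

lemma isLittleO_of_tendsto_ratio {n : ℕ → ℕ} {t : ℝ} (ht : 0 < t)
    (hn : Tendsto (fun k : ℕ => (k : ℝ) / (n k : ℝ)) atTop (𝓝 t)) (C D : ℝ) :
    (fun k : ℕ => |(k : ℝ) - n k * t| * C + D) =o[atTop] (fun k : ℕ => (n k : ℝ)) := by
  have hev : ∀ᶠ k : ℕ in atTop, 0 < (n k : ℝ) ∧ (k : ℝ) ≤ (t + 1) * n k := by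
    filter_upwards [hn.eventually (lt_mem_nhds ht), hn.eventually (gt_mem_nhds (lt_add_one t))]
      with k h1 h2
    have hpos : 0 < (n k : ℝ) := by
      -- Block length `0` would make the ratio `0`, which is excluded near `t > 0`.
      refine (Nat.cast_nonneg _).lt_of_ne' fun h => ?_
      rw [h, div_zero] at h1
      exact lt_irrefl _ h1
    exact ⟨hpos, ((div_lt_iff₀ hpos).1 h2).le⟩
  have htop : Tendsto (fun k : ℕ => (n k : ℝ)) atTop atTop := by
    refine tendsto_atTop_mono' _ (f₁ := fun k : ℕ => (k : ℝ) / (t + 1)) ?_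
      (tendsto_natCast_atTop_atTop.atTop_div_const (by linarith))
    filter_upwards [hev] with k hk
    rw [div_le_iff₀ (by linarith)]
    linarith [hk.2]
  have h1 : (fun k : ℕ => (k : ℝ) - n k * t) =o[atTop] (fun k : ℕ => (n k : ℝ)) := by
    rw [isLittleO_iff_tendsto' (hev.mono fun k hk h => absurd h hk.1.ne')]
    have : Tendsto (fun k : ℕ => (k : ℝ) / (n k : ℝ) - t) atTop (𝓝 0) := by
      simpa using hn.sub_const t
    refine this.congr' (hev.mono fun k hk => ?_)
    have := hk.1.ne'
    field_simp
  have h2 : (fun k : ℕ => |(k : ℝ) - n k * t| * C) =o[atTop] (fun k : ℕ => (n k : ℝ)) := by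
    simp_rw [mul_comm _ C]
    exact (isLittleO_abs_left.2 h1).const_mul_left C
  exact h2.add (isLittleO_const_left.2 (Or.inr (tendsto_norm_atTop_atTop.comp htop)))

/-- Messages whose probability is at most the threshold `exp (k b)` form class `0`, the others
form class `1`. -/
noncomputable def thresholdClass {V : Type*} (P : V → ℝ) (b : ℝ) (k : ℕ) (v : Fin k → V) : Fin 2 :=
  open Classical in if iidProb P v ≤ Real.exp (k * b) then 0 else 1

/-- Two threshold classes attain the exponent given by a supporting line. -/
theorem ensembleErrorProb_thresholdClass_le {V X Y : Type*} [Fintype V] [DecidableEq V]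
    [Nonempty V] [Fintype X] [Fintype Y] {P : V → ℝ} (hP : P ∈ stdSimplex ℝ V) {W : X → Y → ℝ}
    (hW : ∀ x, W x ∈ stdSimplex ℝ Y) {t m M : ℝ} {ρ : Fin 2 → ℝ} {Q : Fin 2 → X → ℝ}
    (hm : 0 ≤ m) (hρ : ∀ i, ρ i ∈ Icc (0 : ℝ) 1) (h0 : ρ 0 ≤ m) (h1 : m ≤ ρ 1)
    (hQ : ∀ i, Q i ∈ stdSimplex ℝ X)
    (he : ∀ i, E0 W (Q i) (ρ i) = M + t * Es P m + t * tiltedEntropy P m * (ρ i - m)) (k n : ℕ) :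
    ensembleErrorProb n P W (thresholdClass P (tiltedLog P m) k) Q
      ≤ Real.exp (-(n : ℝ) * M + (|(k : ℝ) - n * t| *
        ∑ i, |Es P m + (ρ i - m) * tiltedEntropy P m| + Real.log 4)) := by
  set c : Fin 2 → ℝ := fun i => Es P m + (ρ i - m) * tiltedEntropy P m with hc
  have hterm : ∀ i, (∑ v, if thresholdClass P (tiltedLog P m) k v = i then
        iidProb P v ^ (1 / (1 + ρ i)) else 0) ^ (1 + ρ i) * gallagerSum W (Q i) (ρ i) ^ n
      ≤ Real.exp (-(n : ℝ) * M + |(k : ℝ) - n * t| * ∑ i, |c i|) := by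
    intro i
    have hcl := class_partitionSum_le hP hm (hρ i).1
      (fun v => thresholdClass P (tiltedLog P m) k v = i) fun v hv => by
        unfold thresholdClass at hv
        split_ifs at hv with hlt
        · subst hv; exact Or.inl ⟨hlt, h0⟩
        · subst hv; exact Or.inr ⟨(not_le.1 hlt).le, h1⟩
    rw [gallagerSum_eq_exp hW (hQ i), ← Real.exp_nat_mul]
    refine (mul_le_mul_of_nonneg_right hcl (Real.exp_pos _).le).trans ?_
    rw [← Real.exp_add, Real.exp_le_exp, he i]
    -- Since `E0 W (Q i) (ρ i) = M + t * c i`, the exponent `k * c i - n * E0` is `-n * M` plus this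
    -- mismatch between `k` and `n * t`.
    have h2 : ((k : ℝ) - n * t) * c i ≤ |(k : ℝ) - n * t| * ∑ i, |c i| := by
      refine (le_abs_self _).trans ?_
      rw [abs_mul]
      exact mul_le_mul_of_nonneg_left
        (Finset.single_le_sum (f := fun i => |c i|) (fun i _ => abs_nonneg _) (Finset.mem_univ i))
        (abs_nonneg _)
    simp only [hc] at h2 ⊢
    linarith
  refine (ensembleErrorProb_le hP hW hQ hρ n).trans ?_
  -- The constant is `2 * 2`: the factor `N = 2` of the ensemble bound times two class terms.
  have h4 : Real.exp (Real.log 4) = 4 := Real.exp_log (by norm_num)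
  rw [← add_assoc, Real.exp_add, h4]
  have := Finset.sum_le_sum fun i (_ : i ∈ Finset.univ) => hterm i
  rw [Finset.sum_const, Finset.card_univ, Fintype.card_fin, nsmul_eq_mul] at this
  push_cast at this ⊢
  linarith

end JSCC

theorem corollary1 {V X Y : Type*} [Fintype V] [DecidableEq V] [Nonempty V]
    [Fintype X] [Nonempty X] [Fintype Y]
    (P : V → ℝ) (hP : P ∈ stdSimplex ℝ V)
    (W : X → Y → ℝ) (hW : ∀ x, W x ∈ stdSimplex ℝ Y)
    (t : ℝ) (ht : 0 < t) :
    -- Csiszár's exponent is the maximum over `ρ ∈ [0, 1]`, and this maximum is attained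
    JSCC.csiszarExponent P W t = (JSCC.hullExponent P W t : EReal) ∧
    IsGreatest ((fun ρ : ℝ => JSCC.E0hull W ρ - t * JSCC.Es P ρ) '' Icc (0 : ℝ) 1)
      (JSCC.hullExponent P W t) ∧
    -- two classes with one product distribution each attain it
    (∃ Q : Fin 2 → X → ℝ, (∀ i, Q i ∈ stdSimplex ℝ X) ∧
      ∃ cls : (k : ℕ) → (Fin k → V) → Fin 2,
        ∀ n : ℕ → ℕ, Tendsto (fun k : ℕ => (k : ℝ) / (n k : ℝ)) atTop (𝓝 t) →
          ∃ δ : ℕ → ℝ, δ =o[atTop] (fun k : ℕ => (n k : ℝ)) ∧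
            ∀ k : ℕ,
              JSCC.ensembleErrorProb (n k) P W (cls k) Q
                  ≤ Real.exp (-(n k : ℝ) * JSCC.hullExponent P W t + δ k) ∧
              ∃ c : JSCC.Codebook V X k (n k),
                JSCC.errorProb P W c
                  ≤ Real.exp (-(n k : ℝ) * JSCC.hullExponent P W t + δ k)) ∧
    -- it is the sphere-packing exponent where the latter is tight
    (∀ R ∈ JSCC.rateRange P t,
      IsMinOn (JSCC.csiszarObjective P W t) (JSCC.rateRange P t) R →
      JSCC.randomCodingExponent W R = JSCC.spherePackingExponent W R →
      (JSCC.hullExponent P W t : EReal) = JSCC.jointSpherePackingExponent P W t) ∧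
    (∀ R ∈ JSCC.rateRange P t,
      IsMinOn (JSCC.spherePackingObjective P W t) (JSCC.rateRange P t) R →
      JSCC.spherePackingObjective P W t R ≠ ⊤ →
      JSCC.criticalRate W < R →
      (JSCC.hullExponent P W t : EReal) = JSCC.jointSpherePackingExponent P W t) := by
  obtain ⟨m, hm, ρ₁, h₁, ρ₂, h₂, M, h₁m, hm₂, hle, he₁, he₂⟩ :=
    JSCC.exists_supporting_line (P := P) (W := W) hP hW ht
  have hgreat := JSCC.isGreatest_of_supporting_line hP ht hm h₁ h₂ h₁m hm₂ hle he₁ he₂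
  have hM : JSCC.hullExponent P W t = M := hgreat.csSup_eq
  have hCs := JSCC.csiszarExponent_eq_of_supporting_line hP ht hm h₁ h₂ h₁m hm₂ hle he₁ he₂
  rw [hM, ← hCs]
  refine ⟨rfl, hgreat, ?_, fun R hR hmin h =>
      JSCC.exponents_agree_of_isMinOn_csiszarObjective hR hmin h,
    fun R hR hmin hfin hcr =>
      JSCC.exponents_agree_of_isMinOn_spherePackingObjective hW ht hR hmin hfin hcr⟩
  -- The input laws are optimal at the contact points; class `0`, the improbable messages, receives
  -- `ρ₁ ≤ m`.
  obtain ⟨Q₁, hQ₁, hE₁⟩ := JSCC.exists_E0_eq_E0max hW h₁.1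
  obtain ⟨Q₂, hQ₂, hE₂⟩ := JSCC.exists_E0_eq_E0max hW h₂.1
  have hQ : ∀ i, (![Q₁, Q₂] : Fin 2 → X → ℝ) i ∈ stdSimplex ℝ X := Fin.forall_fin_two.2 ⟨hQ₁, hQ₂⟩
  have hbound := JSCC.ensembleErrorProb_thresholdClass_le hP hW (ρ := ![ρ₁, ρ₂]) hm.1
    (Fin.forall_fin_two.2 ⟨h₁, h₂⟩) h₁m hm₂ hQ
    (Fin.forall_fin_two.2 ⟨hE₁.trans he₁, hE₂.trans he₂⟩)
  exact ⟨![Q₁, Q₂], hQ, JSCC.thresholdClass P (JSCC.tiltedLog P m), fun n hn =>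
    ⟨_, JSCC.isLittleO_of_tendsto_ratio ht hn _ _, fun k =>
      ⟨hbound k (n k), JSCC.exists_errorProb_le hQ (hbound k (n k))⟩⟩⟩
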